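/- Let $\mathfrak g$ be a finite-dimensional simple complex Lie algebra with Cartan subalgebra $\mathfrak h$, root system $R$, a choice of simple roots and the corresponding set $R^+$ of positive roots. Fix a Chevalley basis of $\mathfrak g$ with root vectors $x_\alpha^{\pm}$ ($\alpha\in R^+$), and put $h_\alpha=[x_\alpha^+,x_\alpha^-]$. Let $A$ be a commutative associative unital $\mathbb C$-algebra having a $\mathbb C$-basis $\mathbf B$ closed under multiplication. For a complex Lie algebra $\mathfrak a$, let $\mathfrak a\otimes A$ be the map algebra with bracket $[z\otimes a,z'\otimes b]=[z,z']\otimes ab$, and let $U(\mathfrak a\otimes A)$ be its universal enveloping algebra. Let $U_{\mathbb Z}(\mathfrak g\otimes A)$ be the $\mathbb Z$-subalgebra of $U(\mathfrak g\otimes A)$ generated by the divided powers $(x_\alpha^\pm\otimes b)^{(r)}=(x_\alpha^\pm\otimes b)^r/r!$ with $\alpha\in R^+$, $b\in\mathbf B$, $r\ge 0$. Let $\mathcal F$ be the set of finite multisets of elements of $A$, i.e. finitely supported functions $\psi:A\to\mathbb Z_{\ge0}$, ordered pointwise, and let $\mathcal F(\mathbf B)\subset\mathcal F$ be the set of those supported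 in $\mathbf B$. For $\psi\in\mathcal F$ put $|\psi|=\sum_a\psi(a)$, $\pi(\psi)=\prod_a a^{\psi(a)}$, $\mathcal M(\psi)=|\psi|!/\prod_a\psi(a)!$, and let $\chi_a$ be the characteristic function of $a\in A$. Let $\{x^-,h,x^+\}$ be the standard basis of $\mathfrak{sl}_2$. In $U(\mathfrak{sl}_2\otimes A)$ define recursively $p(0,0)=1$ and, for $(\varphi,\chi)\ne(0,0)$, $p(\varphi,\chi)=0$ if $|\varphi|\neq|\chi|$ and otherwise $$p(\varphi,\chi)=-\frac{1}{|\varphi|}\sum_{\substack{0\ne\psi_1\le\varphi\\ 0\ne\psi_2\le\chi}}\mathcal M(\psi_1)\mathcal M(\psi_2)\,\bigl(h\otimes\pi(\psi_1)\pi(\psi_2)\bigr)\,p(\varphi-\psi_1,\chi-\psi_2).$$ Also define $D^\pm(\psi_1,\psi_2,0)=\delta_{|\psi_1|+|\psi_2|,0}$, $D^\pm(\psi_1,\psi_2,\chi_b)=\delta_{|\psi_1|,|\psi_2|}\,\mathcal M(\psi_1)\mathcal M(\psi_2)\,\bigl(x^\pm\otimes b\,\pi(\psi_1)\pi(\psi_2)\bigr)$,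 and, for $\psi_3\ne0$, $$D^\pm(\psi_1,\psi_2,\psi_3)=\frac1{|\psi_3|}\sum_{\substack{\phi_1\le\psi_1\\ \phi_2\le\psi_2}}\ \sum_{b\in\operatorname{supp}\psi_3}D^\pm(\phi_1,\phi_2,\chi_b)\,D^\pm(\psi_1-\phi_1,\psi_2-\phi_2,\psi_3-\chi_b).$$ For $\alpha\in R^+$ let $\Omega_\alpha:U(\mathfrak{sl}_2\otimes A)\to U(\mathfrak g\otimes A)$ be the algebra homomorphism with $x^\pm\otimes a\mapsto x_\alpha^\pm\otimes a$ and $h\otimes a\mapsto h_\alpha\otimes a$, and set $D^\pm_\alpha=\Omega_\alpha\circ D^\pm$, $p_\alpha=\Omega_\alpha\circ p$. Then for every $\alpha\in R^+$: (i) $D^+_\alpha(\varphi,\chi,\psi)\in U_{\mathbb Z}(\mathfrak g\otimes A)$ and $D^-_\alpha(\varphi,\chi,\psi)\in U_{\mathbb Z}(\mathfrak g\otimes A)$ for all $\varphi,\chi,\psi\in\mathcal F(\mathbf B)$; (ii) $p_\alpha(\varphi,\chi)\in U_{\mathbb Z}(\mathfrak g\otimes A)$ for all $\varphi,\chi\in\mathcal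 F(\mathbf B)$. -/

import Mathlib

open scoped TensorProduct

noncomputable section

namespace MapAlg

/-! ## Finite multisets -/

section Multisets

variable {A : Type*}

/-- Finite multisets of elements of `A`: finitely supported functions `A → ℕ`.  The cardinality
`|ψ|` is `Finsupp.degree ψ`, the characteristic function `χ_a` is `Finsupp.single a 1`, the order
is pointwise, and the set `𝓕(χ)` of submultisets of `χ` is `sub χ` below. -/
abbrev FMultiset (A : Type*) : Type _ := A →₀ ℕ

open scoped Classical in
/-- The finite set `𝓕(χ) = {ψ : ψ ≤ χ}`. -/
def sub (χ : FMultiset A) : Finset (FMultiset A) := Finset.Iic χ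

theorem mem_sub {ψ χ : FMultiset A} : ψ ∈ sub χ ↔ ψ ≤ χ := by
  classical
  simp [sub]

/-- `π(ψ) = ∏ a ^ ψ(a)`. -/
def prodElt [CommRing A] (ψ : FMultiset A) : A := ψ.prod fun a n => a ^ n

theorem degree_tsub_lt {φ ψ : FMultiset A} (h : ψ ≤ φ) (h0 : ψ ≠ 0) :
    (φ - ψ).degree < φ.degree := by
  have h1 : (φ - ψ).degree + ψ.degree = φ.degree := by
    rw [← map_add, tsub_add_cancel_of_le h]
  have h2 : ψ.degree ≠ 0 := by simpa [Finsupp.degree_eq_zero_iff] using h0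
  omega

theorem degree_tsub_single_lt {ψ : FMultiset A} {b : A} (hb : b ∈ ψ.support) :
    (ψ - Finsupp.single b 1).degree < ψ.degree := by
  refine degree_tsub_lt ?_ (by simp)
  rw [Finsupp.single_le_iff]
  exact Nat.one_le_iff_ne_zero.mpr (Finsupp.mem_support_iff.mp hb)

end Multisets

/-! ## Map algebras and their universal enveloping algebras -/

section MapAlgebra

attribute [local instance 100] LieRing.ofAssociativeRing

variable (A : Type*) [CommRing A] [Algebra ℂ A]
variable (𝔞 : Type*) [LieRing 𝔞] [LieAlgebra ℂ 𝔞]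

/-- The map algebra `𝔞 ⊗ A`, as a complex Lie algebra with `⁅z ⊗ a, z' ⊗ b⁆ = ⁅z, z'⁆ ⊗ ab`.
Mathlib writes the tensor factors in the opposite order. -/
abbrev MapAlgebra : Type _ := A ⊗[ℂ] 𝔞

/-- The universal enveloping algebra `U(𝔞 ⊗ A)`. -/
abbrev UMap : Type _ := UniversalEnvelopingAlgebra ℂ (MapAlgebra A 𝔞)

variable {A 𝔞}

/-- The element `z ⊗ a` of `𝔞 ⊗ A`, regarded in `U(𝔞 ⊗ A)`. -/
def elt (z : 𝔞) (a : A) : UMap A 𝔞 :=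
  UniversalEnvelopingAlgebra.ι ℂ (a ⊗ₜ[ℂ] z : MapAlgebra A 𝔞)

/-- Divided powers `u^(r) = u ^ r / r!` in a complex algebra. -/
def dividedPower {U : Type*} [Ring U] [Algebra ℂ U] (u : U) (r : ℕ) : U :=
  ((r.factorial : ℂ)⁻¹) • u ^ r

variable {𝔟 : Type*} [LieRing 𝔟] [LieAlgebra ℂ 𝔟]

/-- A Lie algebra homomorphism `f : 𝔞 → 𝔟` induces `f ⊗ id : 𝔞 ⊗ A → 𝔟 ⊗ A`. -/
def mapHom (f : 𝔞 →ₗ⁅ℂ⁆ 𝔟) : MapAlgebra A 𝔞 →ₗ⁅ℂ⁆ MapAlgebra A 𝔟 :=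
  { LinearMap.lTensor A (f : 𝔞 →ₗ[ℂ] 𝔟) with
    map_lie' := by
      intro x y
      simp only [AddHom.toFun_eq_coe, LinearMap.coe_toAddHom]
      induction x using TensorProduct.induction_on with
      | zero => simp
      | add x₁ x₂ h₁ h₂ => simp only [add_lie, map_add, h₁, h₂]
      | tmul a z =>
        induction y using TensorProduct.induction_on with
        | zero => simp
        | add y₁ y₂ h₁ h₂ => simp only [lie_add, map_add, h₁, h₂]
        | tmul b w => simp [LieAlgebra.ExtendScalars.bracket_tmul] }

/-- The algebra homomorphism `U(𝔞 ⊗ A) → U(𝔟 ⊗ A)` with `z ⊗ a ↦ f z ⊗ a`. -/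
def UMap.map (f : 𝔞 →ₗ⁅ℂ⁆ 𝔟) : UMap A 𝔞 →ₐ[ℂ] UMap A 𝔟 :=
  UniversalEnvelopingAlgebra.lift ℂ ((UniversalEnvelopingAlgebra.ι ℂ).comp (mapHom f))

@[simp]
theorem UMap.map_elt (f : 𝔞 →ₗ⁅ℂ⁆ 𝔟) (z : 𝔞) (a : A) :
    UMap.map f (elt z a) = elt (f z) a := by
  rw [UMap.map, elt, UniversalEnvelopingAlgebra.lift_ι_apply]
  rfl

end MapAlgebra

/-! ## The Lie algebra `𝔰𝔩₂` and the elements `p(φ, χ)`, `D^±(ψ₁, ψ₂, ψ₃)` -/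

section SL2

/-- The complex Lie algebra `𝔰𝔩₂` of traceless `2 × 2` matrices. -/
abbrev sl2 : Type := LieAlgebra.SpecialLinear.sl (Fin 2) ℂ

/-- `x⁺ = E₁₂`. -/
def xPlus : sl2 := LieAlgebra.SpecialLinear.single 0 1 (by decide) 1

/-- `x⁻ = E₂₁`. -/
def xMinus : sl2 := LieAlgebra.SpecialLinear.single 1 0 (by decide) 1

/-- `h = E₁₁ - E₂₂`. -/
def hElt : sl2 := LieAlgebra.SpecialLinear.singleSubSingle 0 1 1

variable {A : Type*} [CommRing A] [Algebra ℂ A]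

open scoped Classical in
/-- `p(0, 0) = 1` and otherwise
`p(φ, χ) = - (δ_{|φ|,|χ|} / |φ|) ∑_{0 ≠ ψ₁ ≤ φ} ∑_{0 ≠ ψ₂ ≤ χ}
  𝓜(ψ₁) 𝓜(ψ₂) (h ⊗ π(ψ₁) π(ψ₂)) p(φ - ψ₁, χ - ψ₂)`.
In particular `p(φ, χ) = 0` if exactly one of `φ`, `χ` is zero.  (`Finset.attach` only serves the
termination argument, see `p_eq`.) -/
def p (φ χ : FMultiset A) : UMap A sl2 :=
  if φ = 0 ∧ χ = 0 then 1 else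
    (-((if φ.degree = χ.degree then 1 else 0 : ℂ) / (φ.degree : ℂ))) •
      ∑ ψ₁ ∈ ((sub φ).erase 0).attach, ∑ ψ₂ ∈ (sub χ).erase 0,
        ((ψ₁.1.multinomial : ℂ) * (ψ₂.multinomial : ℂ)) •
          (elt hElt (prodElt ψ₁.1 * prodElt ψ₂) * p (φ - ψ₁.1) (χ - ψ₂))
termination_by φ.degree
decreasing_by
  have h := ψ₁.2
  rw [Finset.mem_erase, mem_sub] at h
  exact degree_tsub_lt h.2 h.1

theorem p_zero : p (0 : FMultiset A) 0 = 1 := by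
  rw [p]; simp

open scoped Classical in
theorem p_eq {φ χ : FMultiset A} (h : ¬(φ = 0 ∧ χ = 0)) :
    p φ χ = (-((if φ.degree = χ.degree then 1 else 0 : ℂ) / (φ.degree : ℂ))) •
      ∑ ψ₁ ∈ (sub φ).erase 0, ∑ ψ₂ ∈ (sub χ).erase 0,
        ((ψ₁.multinomial : ℂ) * (ψ₂.multinomial : ℂ)) •
          (elt hElt (prodElt ψ₁ * prodElt ψ₂) * p (φ - ψ₁) (χ - ψ₂)) := by
  rw [p, if_neg h, ← Finset.sum_attach ((sub φ).erase 0)]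

/-- The element `D(ψ₁, ψ₂, χ_b) = δ_{|ψ₁|,|ψ₂|} 𝓜(ψ₁) 𝓜(ψ₂) (x ⊗ b π(ψ₁) π(ψ₂))`, where `x` is
`x⁺` or `x⁻`. -/
def DSingle (x : sl2) (ψ₁ ψ₂ : FMultiset A) (b : A) : UMap A sl2 :=
  if ψ₁.degree = ψ₂.degree then
    ((ψ₁.multinomial : ℂ) * (ψ₂.multinomial : ℂ)) • elt x (b * prodElt ψ₁ * prodElt ψ₂)
  else 0

/-- `D(ψ₁, ψ₂, 0) = δ_{|ψ₁|+|ψ₂|,0}`, `D(ψ₁, ψ₂, χ_b)` is `DSingle` (see `D_single`), and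
`D(ψ₁, ψ₂, ψ₃) = (1 / |ψ₃|) ∑_{φ₁ ≤ ψ₁} ∑_{φ₂ ≤ ψ₂} ∑_{b ∈ supp ψ₃}
  D(φ₁, φ₂, χ_b) D(ψ₁ - φ₁, ψ₂ - φ₂, ψ₃ - χ_b)`.
Here `x` is `x⁺` for `D⁺` and `x⁻` for `D⁻`.  (`Finset.attach` only serves the termination
argument, see `D_eq`.) -/
def D (x : sl2) (ψ₁ ψ₂ ψ₃ : FMultiset A) : UMap A sl2 :=
  open scoped Classical in
  if ψ₃ = 0 then (if ψ₁.degree + ψ₂.degree = 0 then 1 else 0) else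
    ((ψ₃.degree : ℂ)⁻¹) •
      ∑ φ₁ ∈ sub ψ₁, ∑ φ₂ ∈ sub ψ₂, ∑ b ∈ ψ₃.support.attach,
        DSingle x φ₁ φ₂ b.1 * D x (ψ₁ - φ₁) (ψ₂ - φ₂) (ψ₃ - Finsupp.single b.1 1)
termination_by ψ₃.degree
decreasing_by exact degree_tsub_single_lt b.2

theorem D_zero (x : sl2) (ψ₁ ψ₂ : FMultiset A) :
    D x ψ₁ ψ₂ 0 = if ψ₁.degree + ψ₂.degree = 0 then 1 else 0 := by
  rw [D]; simp

theorem D_eq' (x : sl2) (ψ₁ ψ₂ : FMultiset A) {ψ₃ : FMultiset A} (h : ψ₃ ≠ 0) :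
    D x ψ₁ ψ₂ ψ₃ = ((ψ₃.degree : ℂ)⁻¹) •
      ∑ φ₁ ∈ sub ψ₁, ∑ φ₂ ∈ sub ψ₂, ∑ b ∈ ψ₃.support,
        DSingle x φ₁ φ₂ b * D x (ψ₁ - φ₁) (ψ₂ - φ₂) (ψ₃ - Finsupp.single b 1) := by
  rw [D, if_neg h]
  congr 1
  refine Finset.sum_congr rfl fun φ₁ _ => Finset.sum_congr rfl fun φ₂ _ => ?_
  rw [← Finset.sum_attach ψ₃.support]

theorem D_single (x : sl2) (ψ₁ ψ₂ : FMultiset A) (b : A) :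
    D x ψ₁ ψ₂ (Finsupp.single b 1) = DSingle x ψ₁ ψ₂ b := by
  rw [D_eq' x ψ₁ ψ₂ (by simp)]
  have hsupp : (Finsupp.single b 1 : FMultiset A).support = {b} :=
    by simp [Finsupp.support_single]
  simp only [hsupp, Finset.sum_singleton, tsub_self, D_zero, Finsupp.degree_single, Nat.cast_one,
    inv_one, one_smul]
  rw [Finset.sum_eq_single_of_mem ψ₁ (mem_sub.mpr le_rfl)]
  · rw [Finset.sum_eq_single_of_mem ψ₂ (mem_sub.mpr le_rfl)]
    · simp
    · intro φ₂ h2 hne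
      have : (ψ₂ - φ₂).degree ≠ 0 := fun h => hne (le_antisymm (mem_sub.mp h2)
        (tsub_eq_zero_iff_le.mp ((Finsupp.degree_eq_zero_iff _).mp h)))
      simp [this]
  · intro φ₁ h1 hne
    have : (ψ₁ - φ₁).degree ≠ 0 := fun h => hne (le_antisymm (mem_sub.mp h1)
      (tsub_eq_zero_iff_le.mp ((Finsupp.degree_eq_zero_iff _).mp h)))
    simp [this]

theorem D_eq (x : sl2) (ψ₁ ψ₂ : FMultiset A) {ψ₃ : FMultiset A} (h : ψ₃ ≠ 0) :
    D x ψ₁ ψ₂ ψ₃ = ((ψ₃.degree : ℂ)⁻¹) •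
      ∑ φ₁ ∈ sub ψ₁, ∑ φ₂ ∈ sub ψ₂, ∑ b ∈ ψ₃.support,
        D x φ₁ φ₂ (Finsupp.single b 1) *
          D x (ψ₁ - φ₁) (ψ₂ - φ₂) (ψ₃ - Finsupp.single b 1) := by
  simp only [D_single]
  exact D_eq' x ψ₁ ψ₂ h

variable {L : Type*} [LieRing L] [LieAlgebra ℂ L]

/-- The Lie algebra homomorphism `𝔰𝔩₂ → L` with `h ↦ h`, `x⁺ ↦ e`, `x⁻ ↦ f` attached to an
`𝔰𝔩₂`-triple `(h, e, f)` of `L`. -/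
def sl2Hom {h e f : L} (t : IsSl2Triple h e f) : sl2 →ₗ⁅ℂ⁆ L where
  toFun m := m.1 0 1 • e + m.1 1 0 • f + m.1 0 0 • h
  map_add' m n := by
    change (m.1 + n.1) 0 1 • e + (m.1 + n.1) 1 0 • f + (m.1 + n.1) 0 0 • h = _
    simp only [Matrix.add_apply, add_smul]
    abel
  map_smul' c m := by
    change (c • m.1) 0 1 • e + (c • m.1) 1 0 • f + (c • m.1) 0 0 • h = _
    simp [mul_smul]
  map_lie' := by
    intro m n
    have hm : m.1 1 1 = - m.1 0 0 := by
      have := m.2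
      have h2 : Matrix.trace m.1 = 0 := this
      rw [Matrix.trace_fin_two] at h2
      linear_combination h2
    have hn : n.1 1 1 = - n.1 0 0 := by
      have := n.2
      have h2 : Matrix.trace n.1 = 0 := this
      rw [Matrix.trace_fin_two] at h2
      linear_combination h2
    have h1 : ⁅e, f⁆ = h := t.lie_e_f
    have h1' : ⁅f, e⁆ = -h := by rw [← lie_skew, h1]
    have h2 : ⁅h, e⁆ = (2 : ℂ) • e := t.lie_h_e_smul ℂ
    have h2' : ⁅e, h⁆ = -((2 : ℂ) • e) := by rw [← lie_skew, h2]
    have h3 : ⁅h, f⁆ = -((2 : ℂ) • f) := t.lie_lie_smul_f ℂ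
    have h3' : ⁅f, h⁆ = (2 : ℂ) • f := by rw [← lie_skew, h3, neg_neg]
    rw [LieAlgebra.SpecialLinear.sl_bracket]
    simp only [Matrix.sub_apply, Matrix.mul_apply, Fin.sum_univ_two, hm, hn, add_lie, lie_add,
      smul_lie, lie_smul, lie_self, h1, h1', h2, h2', h3, h3']
    module

theorem sl2Hom_xPlus {h e f : L} (t : IsSl2Triple h e f) : sl2Hom t xPlus = e := by
  simp [sl2Hom, xPlus]

theorem sl2Hom_xMinus {h e f : L} (t : IsSl2Triple h e f) : sl2Hom t xMinus = f := by
  simp [sl2Hom, xMinus]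

theorem sl2Hom_hElt {h e f : L} (t : IsSl2Triple h e f) : sl2Hom t hElt = h := by
  simp [sl2Hom, hElt]

end SL2

/-! ## Chevalley bases and the integral form -/

section Chevalley

open LieAlgebra LieAlgebra.IsKilling

variable {𝔤 : Type*} [LieRing 𝔤] [LieAlgebra ℂ 𝔤] [FiniteDimensional ℂ 𝔤] [IsKilling ℂ 𝔤]
variable {H : LieSubalgebra ℂ 𝔤} [H.IsCartanSubalgebra]

/-- The root `-α`. -/
def negRoot (α : H.root) : H.root :=
  ⟨-α.1, by
    have hα : α.1.IsNonZero := (Finset.mem_filter.mp α.2).2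
    simpa [LieSubalgebra.root] using hα⟩

variable (H) in
/-- The root vectors `x_α` (`α ∈ R`) of a Chevalley basis of `𝔤` relative to the Cartan
subalgebra `H`: `x_α` is in the root space of `α`; `⁅x_α, x_{-α}⁆` is the coroot `h_α`; and whenever
`α`, `β`, `α + β` are roots, the structure constants satisfy `c_{α,β} = -c_{-α,-β}`.
Once a set of simple roots is chosen, one writes `x_α⁺ = x_α` and `x_α⁻ = x_{-α}` for a positive
root `α`; the remaining members `h_i` of the basis are the simple coroots. -/
structure ChevalleyBasis where
  /-- The root vectors. -/
  x : H.root → 𝔤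
  mem_rootSpace (α : H.root) : x α ∈ rootSpace H (α.1 : H → ℂ)
  lie_neg (α : H.root) : ⁅x α, x (negRoot α)⁆ = (coroot α.1 : 𝔤)
  lie_add (α β γ : H.root) (h : (rootSystem H).root γ = (rootSystem H).root α +
      (rootSystem H).root β) :
    ∃ c : ℂ, ⁅x α, x β⁆ = c • x γ ∧ ⁅x (negRoot α), x (negRoot β)⁆ = (-c) • x (negRoot γ)

theorem ChevalleyBasis.isSl2Triple (X : ChevalleyBasis H) (α : H.root) :
    IsSl2Triple (coroot α.1 : 𝔤) (X.x α) (X.x (negRoot α)) := by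
  have hα : α.1.IsNonZero := (Finset.mem_filter.mp α.2).2
  have h2 : (α.1 : H → ℂ) (coroot α.1) = 2 := root_apply_coroot hα
  refine ⟨?_, X.lie_neg α, ?_, ?_⟩
  · intro h
    have : coroot α.1 = 0 := by exact_mod_cast h
    rw [this] at h2
    simp at h2
  · have := lie_eq_smul_of_mem_rootSpace (X.mem_rootSpace α) (coroot α.1)
    rw [h2, LieSubalgebra.coe_bracket_of_module] at this
    rw [this, ofNat_smul_eq_nsmul]
  · have := lie_eq_smul_of_mem_rootSpace (X.mem_rootSpace (negRoot α)) (coroot α.1)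
    rw [LieSubalgebra.coe_bracket_of_module] at this
    rw [this]
    simp [negRoot, h2, ofNat_smul_eq_nsmul]

/-- The set `R⁺ = R ∩ Q⁺` of positive roots, where `Q⁺` is the set of non-negative integral
combinations of the simple roots. -/
def positiveRoots (b : (rootSystem H).Base) : Set H.root :=
  {α | (rootSystem H).root α ∈ AddSubmonoid.closure ((rootSystem H).root '' b.support)}

variable {A : Type*} [CommRing A] [Algebra ℂ A]

/-- The algebra homomorphism `Ω_α : U(𝔰𝔩₂ ⊗ A) → U(𝔤 ⊗ A)` with `x^± ⊗ a ↦ x_α^± ⊗ a` and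
`h ⊗ a ↦ h_α ⊗ a`. -/
def Omega (X : ChevalleyBasis H) (α : H.root) : UMap A sl2 →ₐ[ℂ] UMap A 𝔤 :=
  UMap.map (sl2Hom (X.isSl2Triple α))

theorem Omega_xPlus (X : ChevalleyBasis H) (α : H.root) (a : A) :
    Omega X α (elt xPlus a) = elt (X.x α) a := by
  rw [Omega, UMap.map_elt, sl2Hom_xPlus]

theorem Omega_xMinus (X : ChevalleyBasis H) (α : H.root) (a : A) :
    Omega X α (elt xMinus a) = elt (X.x (negRoot α)) a := by
  rw [Omega, UMap.map_elt, sl2Hom_xMinus]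

theorem Omega_hElt (X : ChevalleyBasis H) (α : H.root) (a : A) :
    Omega X α (elt hElt a) = elt (coroot α.1 : 𝔤) a := by
  rw [Omega, UMap.map_elt, sl2Hom_hElt]

/-- `D_α⁺(φ, χ, ψ) = Ω_α (D⁺(φ, χ, ψ))`. -/
def DPlus (X : ChevalleyBasis H) (α : H.root) (φ χ ψ : FMultiset A) : UMap A 𝔤 :=
  Omega X α (D xPlus φ χ ψ)

/-- `D_α⁻(φ, χ, ψ) = Ω_α (D⁻(φ, χ, ψ))`. -/
def DMinus (X : ChevalleyBasis H) (α : H.root) (φ χ ψ : FMultiset A) : UMap A 𝔤 :=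
  Omega X α (D xMinus φ χ ψ)

/-- `p_α(φ, χ) = Ω_α (p(φ, χ))`. -/
def pRoot (X : ChevalleyBasis H) (α : H.root) (φ χ : FMultiset A) : UMap A 𝔤 :=
  Omega X α (p φ χ)

/-- `U_ℤ(𝔤 ⊗ A)`: the `ℤ`-subalgebra of `U(𝔤 ⊗ A)` generated by all divided powers
`(x_α^± ⊗ b)^(r)` with `α ∈ R⁺`, `b ∈ B` and `r ≥ 0`. -/
def UZ (b : (rootSystem H).Base) (X : ChevalleyBasis H) (B : Set A) : Subalgebra ℤ (UMap A 𝔤) :=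
  Algebra.adjoin ℤ
    {u | ∃ α ∈ positiveRoots b, ∃ a ∈ B, ∃ r : ℕ,
      u = dividedPower (elt (X.x α) a) r ∨ u = dividedPower (elt (X.x (negRoot α)) a) r}

end Chevalley

end MapAlg

end

/-!
Everything happens in `U(𝔰𝔩₂ ⊗ A)`, with the preimage `Z` of the integral form under `Ω_α`; the only
property of `Z` that matters is that it contains the divided powers of `x^± ⊗ b` for `b ∈ B`.
Introduce commuting variables `s_a`, `t_a` (`a ∈ A`) and the series `S = ∑ a s_a`, `T = ∑ a t_a`.
Then `(1 - ST)⁻¹` has the coefficient `𝓜(φ) 𝓜(χ) π(φ) π(χ)` at `s^φ t^χ` if `|φ| = |χ|`, and `0`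
otherwise (`coeff_geomSeries`, `geomSeries_eq`).

The recursion for `D` says that `D^±(φ, χ, ψ)` is the coefficient of `s^φ t^χ w^ψ` in the divided
power of order `|ψ|` of `∑ w_b (x^± ⊗ b (1 - ST)⁻¹)` (`coeff_dividedPower_seriesD`). A power series
whose coefficients commute and have integral divided powers has integral divided powers itself
(`hasDividedPowers_series`), which gives the integrality of `D^±`.

The recursion for `p` says that the generating series `P = ∑ p(φ, χ) s^φ t^χ` solves
`θ P = -(h ⊗ ST (1 - ST)⁻¹) P`, with `θ` the Euler operator in the variables `s` (`euler_seriesP`);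
informally, `P = exp (h ⊗ log (1 - ST))`. The matrix identity in `SL₂`
`diag (g⁻¹, g) = [1, 0; Tg, 1] [1, S; 0, 1] [1, 0; -T, 1] [1, -Sg; 0, 1]`, with `g = (1 - ST)⁻¹`,
suggests
`P = exp (x⁻ ⊗ Tg) exp (x⁺ ⊗ S) exp (-x⁻ ⊗ T) exp (-x⁺ ⊗ Sg)`.
Indeed the right-hand side solves the same differential equation with the same initial value
(`IsCurrentSl2.eq_mvExp_prod`), by the conjugation formula for exponentials `mvExp_mul`. The four
exponentials have integral coefficients, hence so does `P`.
-/

open Finset.HasAntidiagonal (antidiagonal mem_antidiagonal)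

noncomputable section

namespace MapAlg

/-! ### Divided powers in a complex algebra -/

section DividedPowers

variable {U : Type*} [Ring U] [Algebra ℂ U]

@[simp]
theorem dividedPower_zero_right (u : U) : dividedPower u 0 = 1 := by
  simp [dividedPower]

theorem dividedPower_succ (u : U) (n : ℕ) :
    dividedPower u (n + 1) = ((n : ℂ) + 1)⁻¹ • (u * dividedPower u n) := by
  simp only [dividedPower, Nat.factorial_succ, Nat.cast_mul, mul_inv, pow_succ', mul_smul_comm,
    smul_smul, Nat.cast_add, Nat.cast_one]

theorem succ_nsmul_dividedPower_succ (u : U) (n : ℕ) :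
    (n + 1) • dividedPower u (n + 1) = u * dividedPower u n := by
  have h : (n : ℂ) + 1 ≠ 0 := Nat.cast_add_one_ne_zero n
  rw [dividedPower_succ, ← Nat.cast_smul_eq_nsmul ℂ, smul_smul, Nat.cast_add, Nat.cast_one,
    mul_inv_cancel₀ h, one_smul]

theorem dividedPower_neg (u : U) (n : ℕ) :
    dividedPower (-u) n = (-1) ^ n * dividedPower u n := by
  rw [dividedPower, neg_pow, dividedPower, mul_smul_comm]

theorem dividedPower_add {u v : U} (h : Commute u v) (n : ℕ) :
    dividedPower (u + v) n =
      ∑ ij ∈ antidiagonal n, dividedPower u ij.1 * dividedPower v ij.2 := by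
  rw [dividedPower, h.add_pow', Finset.smul_sum]
  refine Finset.sum_congr rfl fun ij hij => ?_
  obtain rfl := mem_antidiagonal.mp hij
  rw [dividedPower, dividedPower, smul_mul_smul_comm, ← Nat.cast_smul_eq_nsmul ℂ, smul_smul]
  congr 1
  have h1 : (((ij.1 + ij.2).choose ij.1 : ℕ) : ℂ) * (ij.1.factorial * ij.2.factorial)
      = (ij.1 + ij.2).factorial := by
    rw [add_comm ij.1, ← mul_assoc, mul_right_comm]
    exact_mod_cast Nat.add_choose_mul_factorial_mul_factorial ij.2 ij.1
  have h2 : ((ij.1.factorial : ℕ) : ℂ) ≠ 0 := by exact_mod_cast ij.1.factorial_ne_zero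
  have h3 : ((ij.2.factorial : ℕ) : ℂ) ≠ 0 := by exact_mod_cast ij.2.factorial_ne_zero
  have h4 : (((ij.1 + ij.2).factorial : ℕ) : ℂ) ≠ 0 := by
    exact_mod_cast (ij.1 + ij.2).factorial_ne_zero
  field_simp
  linear_combination h1

/-- `u` has all its divided powers in the subring `Z`. -/
def HasDividedPowers (Z : Subring U) (u : U) : Prop := ∀ r, dividedPower u r ∈ Z

variable {Z : Subring U} {u v : U}

theorem hasDividedPowers_zero : HasDividedPowers Z (0 : U) := by
  rintro (_ | r)
  · simp
  · simp [dividedPower]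

theorem HasDividedPowers.add (hu : HasDividedPowers Z u) (hv : HasDividedPowers Z v)
    (h : Commute u v) : HasDividedPowers Z (u + v) := fun r => by
  rw [dividedPower_add h]
  exact Z.sum_mem fun ij _ => Z.mul_mem (hu _) (hv _)

theorem HasDividedPowers.neg (hu : HasDividedPowers Z u) : HasDividedPowers Z (-u) := fun r => by
  rw [dividedPower_neg]
  exact Z.mul_mem (Z.pow_mem (Z.neg_mem Z.one_mem) _) (hu r)

theorem HasDividedPowers.sum {ι : Type*} (s : Finset ι) (f : ι → U)
    (hf : ∀ i ∈ s, HasDividedPowers Z (f i)) (hc : ∀ i ∈ s, ∀ j ∈ s, Commute (f i) (f j)) :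
    HasDividedPowers Z (∑ i ∈ s, f i) := by
  classical
  induction s using Finset.induction_on with
  | empty => simpa using hasDividedPowers_zero
  | insert a s ha ih =>
    rw [Finset.sum_insert ha]
    refine (hf a (by simp)).add (ih (fun i hi => hf i (by simp [hi]))
      fun i hi j hj => hc i (by simp [hi]) j (by simp [hj])) ?_
    exact Commute.sum_right _ _ _ fun i hi => hc a (by simp) i (by simp [hi])

end DividedPowers

/-! ### Power series with integral coefficients -/

section Series

open MvPowerSeries

variable {σ R : Type*} [Ring R]

/-- The series whose coefficients at the monomials in the variables from `s` lie in `Z`; there is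
no condition on the other coefficients. -/
def seriesSubring (Z : Subring R) (s : Set σ) : Subring (MvPowerSeries σ R) where
  carrier := {f | ∀ m : σ →₀ ℕ, (m.support : Set σ) ⊆ s → coeff m f ∈ Z}
  zero_mem' m _ := by simp
  one_mem' m _ := by
    classical
    rw [coeff_one]
    split_ifs
    · exact Z.one_mem
    · exact Z.zero_mem
  add_mem' hf hg m hm := by
    rw [map_add]
    exact Z.add_mem (hf m hm) (hg m hm)
  neg_mem' hf m hm := by
    rw [map_neg]
    exact Z.neg_mem (hf m hm)
  mul_mem' hf hg m hm := by
    classical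
    rw [coeff_mul]
    refine Z.sum_mem fun ij hij => ?_
    obtain rfl := mem_antidiagonal.mp hij
    have h1 : ij.1.support ⊆ (ij.1 + ij.2).support := Finsupp.support_mono le_self_add
    have h2 : ij.2.support ⊆ (ij.1 + ij.2).support := Finsupp.support_mono le_add_self
    exact Z.mul_mem (hf _ ((Finset.coe_subset.mpr h1).trans hm))
      (hg _ ((Finset.coe_subset.mpr h2).trans hm))

theorem commute_of_coeff {f g : MvPowerSeries σ R}
    (h : ∀ m n, Commute (coeff m f) (coeff n g)) : Commute f g := by
  classical
  ext m
  rw [coeff_mul, coeff_mul, Finsupp.sum_antidiagonal_swap m fun i j => coeff i f * coeff j g]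
  exact Finset.sum_congr rfl fun ij _ => h _ _

theorem coeff_pow_congr {f g : MvPowerSeries σ R} {m : σ →₀ ℕ}
    (h : ∀ n ≤ m, coeff n f = coeff n g) (k : ℕ) :
    ∀ n ≤ m, coeff n (f ^ k) = coeff n (g ^ k) := by
  classical
  induction k with
  | zero => simp
  | succ k ih =>
    intro n hn
    rw [pow_succ, pow_succ, coeff_mul, coeff_mul]
    refine Finset.sum_congr rfl fun ij hij => ?_
    obtain rfl := mem_antidiagonal.mp hij
    rw [ih _ (le_self_add.trans hn), h _ (le_add_self.trans hn)]

theorem coeff_complex_smul [Algebra ℂ R] (c : ℂ) (m : σ →₀ ℕ) (f : MvPowerSeries σ R) :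
    coeff m (c • f) = c • coeff m f := rfl

theorem dividedPower_monomial [Algebra ℂ R] (m : σ →₀ ℕ) (u : R) (k : ℕ) :
    dividedPower (monomial m u) k = monomial (k • m) (dividedPower u k) := by
  have h : (monomial m u) ^ k = monomial (k • m) (u ^ k) := by
    induction k with
    | zero => simp
    | succ k ih => rw [pow_succ, ih, monomial_mul_monomial, pow_succ, add_smul, one_smul]
  classical
  ext n
  rw [dividedPower, h, coeff_complex_smul, coeff_monomial, coeff_monomial, dividedPower]
  split_ifs <;> simp

/-- Divided powers of a series with pairwise commuting coefficients are integral as soon as those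
of its coefficients are: modulo monomials not dividing a given one, the series is a finite sum of
commuting monomials. -/
theorem hasDividedPowers_series [Algebra ℂ R] {Z : Subring R} {s : Set σ} {f : MvPowerSeries σ R}
    (hc : ∀ m n, Commute (coeff m f) (coeff n f))
    (hf : ∀ m : σ →₀ ℕ, (m.support : Set σ) ⊆ s → HasDividedPowers Z (coeff m f)) :
    HasDividedPowers (seriesSubring Z s) f := by
  classical
  intro r m hm
  let g : MvPowerSeries σ R := ∑ n ∈ Finset.Iic m, monomial n (coeff n f)
  have hfg : ∀ n ≤ m, coeff n f = coeff n g := by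
    intro n hn
    simp only [g, map_sum, coeff_monomial]
    rw [Finset.sum_ite_eq, if_pos (Finset.mem_Iic.mpr hn)]
  have hg : HasDividedPowers (seriesSubring Z s) g := by
    refine HasDividedPowers.sum _ _ (fun n hn k => ?_) fun i _ j _ => ?_
    · have hns : (n.support : Set σ) ⊆ s :=
        (Finset.coe_subset.mpr (Finsupp.support_mono (Finset.mem_Iic.mp hn))).trans hm
      rw [dividedPower_monomial]
      intro l hl
      rw [coeff_monomial]
      split_ifs
      · exact hf n hns k
      · exact Z.zero_mem
    · refine commute_of_coeff fun k l => ?_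
      rw [coeff_monomial, coeff_monomial]
      split_ifs
      · exact hc _ _
      · exact Commute.zero_right _
      · exact Commute.zero_left _
      · exact Commute.zero_left _
  have key := hg r m hm
  rw [dividedPower, coeff_complex_smul] at key ⊢
  rwa [coeff_pow_congr hfg r m le_rfl]

end Series

/-! ### Exponentials and Euler operators -/

section Exponential

open MvPowerSeries

variable {σ R : Type*} [Ring R]

theorem coeff_mul_congr {f f' g g' : MvPowerSeries σ R} {m : σ →₀ ℕ}
    (hf : ∀ n ≤ m, coeff n f = coeff n f') (hg : ∀ n ≤ m, coeff n g = coeff n g') :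
    coeff m (f * g) = coeff m (f' * g') := by
  classical
  rw [coeff_mul, coeff_mul]
  refine Finset.sum_congr rfl fun ij hij => ?_
  obtain rfl := mem_antidiagonal.mp hij
  rw [hf _ le_self_add, hg _ le_add_self]

variable (w : (σ →₀ ℕ) →+ ℕ)

/-- The Euler operator of the grading in which the monomial with exponent `m` has weight `w m`. -/
def euler : MvPowerSeries σ R →+ MvPowerSeries σ R where
  toFun f m := w m • f m
  map_zero' := by
    ext m
    exact smul_zero _
  map_add' f g := by
    ext m
    exact smul_add _ _ _

theorem coeff_euler (f : MvPowerSeries σ R) (m : σ →₀ ℕ) :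
    coeff m (euler w f) = w m • coeff m f := rfl

theorem euler_mul (f g : MvPowerSeries σ R) :
    euler w (f * g) = euler w f * g + f * euler w g := by
  classical
  ext m
  rw [map_add, coeff_euler, coeff_mul, coeff_mul, coeff_mul, ← Finset.sum_add_distrib,
    Finset.smul_sum]
  refine Finset.sum_congr rfl fun ij hij => ?_
  obtain rfl := mem_antidiagonal.mp hij
  rw [coeff_euler, coeff_euler, map_add, add_smul, smul_mul_assoc, mul_smul_comm]

@[simp]
theorem euler_one : euler w (1 : MvPowerSeries σ R) = 0 := by
  classical
  ext m
  rw [coeff_euler, coeff_one]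
  split_ifs with h <;> simp [h]

/-- The part of weight zero of a series. -/
def weightZero : MvPowerSeries σ R →+* MvPowerSeries σ R where
  toFun f m := if w m = 0 then f m else 0
  map_zero' := by
    ext m
    exact ite_self _
  map_one' := by
    classical
    ext m
    change (if w m = 0 then coeff m 1 else 0) = coeff m 1
    rw [coeff_one]
    split_ifs with h1 h2 h2 <;> simp_all
  map_add' f g := by
    ext m
    change (if w m = 0 then coeff m (f + g) else 0) =
      (if w m = 0 then coeff m f else 0) + (if w m = 0 then coeff m g else 0)
    split_ifs <;> simp
  map_mul' f g := by
    classical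
    ext m
    refine Eq.trans ?_ (coeff_mul m _ _).symm
    change (if w m = 0 then coeff m (f * g) else 0) = _
    rw [coeff_mul]
    split_ifs with h
    · refine Finset.sum_congr rfl fun ij hij => ?_
      obtain rfl := mem_antidiagonal.mp hij
      rw [map_add, add_eq_zero] at h
      change _ = (if w ij.1 = 0 then coeff ij.1 f else 0) * (if w ij.2 = 0 then coeff ij.2 g else 0)
      rw [if_pos h.1, if_pos h.2]
    · refine (Finset.sum_eq_zero fun ij hij => ?_).symm
      obtain rfl := mem_antidiagonal.mp hij
      change (if w ij.1 = 0 then coeff ij.1 f else 0) * (if w ij.2 = 0 then coeff ij.2 g else 0) = 0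
      rw [map_add, add_eq_zero, not_and_or] at h
      rcases h with h | h <;> simp [h]

theorem coeff_weightZero (f : MvPowerSeries σ R) (m : σ →₀ ℕ) :
    coeff m (weightZero w f) = if w m = 0 then coeff m f else 0 := rfl

variable [Algebra ℂ R]

/-- A linear differential equation for the Euler operator, with coefficient of positive weight,
determines its solution from the weight-zero part. -/
theorem eq_of_euler_eq_mul {u f g : MvPowerSeries σ R} (hu : weightZero w u = 0)
    (hf : euler w f = u * f) (hg : euler w g = u * g) (h : weightZero w f = weightZero w g) :
    f = g := by
  classical
  ext m
  induction hn : w m using Nat.strong_induction_on generalizing m with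
  | _ n ih =>
    rcases Nat.eq_zero_or_pos n with rfl | hpos
    · simpa [coeff_weightZero, hn] using congrArg (coeff m) h
    · have key : w m • coeff m f = w m • coeff m g := by
        rw [← coeff_euler, ← coeff_euler, hf, hg, coeff_mul, coeff_mul]
        refine Finset.sum_congr rfl fun ij hij => ?_
        obtain rfl := mem_antidiagonal.mp hij
        by_cases h1 : w ij.1 = 0
        · have := congrArg (coeff ij.1) hu
          rw [coeff_weightZero, if_pos h1, coeff_zero] at this
          rw [this, zero_mul, zero_mul]
        · rw [ih (w ij.2) (by rw [← hn, map_add]; omega) ij.2 rfl]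
      rw [← Nat.cast_smul_eq_nsmul ℂ, ← Nat.cast_smul_eq_nsmul ℂ] at key
      exact smul_right_injective R (Nat.cast_ne_zero.mpr (by omega)) key

theorem euler_smul (c : ℂ) (f : MvPowerSeries σ R) : euler w (c • f) = c • euler w f := by
  ext m
  rw [coeff_euler, coeff_complex_smul, coeff_complex_smul, coeff_euler, smul_comm]

theorem euler_dividedPower_succ {a : MvPowerSeries σ R} (h : Commute (euler w a) a) (n : ℕ) :
    euler w (dividedPower a (n + 1)) = euler w a * dividedPower a n := by
  induction n with
  | zero => simp [dividedPower]
  | succ n ih =>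
    have hc : a * (euler w a * dividedPower a n) =
        euler w a * ((n + 1) • dividedPower a (n + 1)) := by
      rw [succ_nsmul_dividedPower_succ, ← mul_assoc, ← h.eq, mul_assoc]
    rw [dividedPower_succ, euler_smul, euler_mul, ih, hc, mul_smul_comm, ← succ_nsmul',
      ← Nat.cast_smul_eq_nsmul ℂ, smul_smul, Nat.cast_add (n + 1) 1, Nat.cast_one,
      inv_mul_cancel₀ (Nat.cast_add_one_ne_zero _), one_smul]

theorem coeff_dividedPower_eq_zero {a : MvPowerSeries σ R} (ha : constantCoeff a = 0) {k : ℕ}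
    {m : σ →₀ ℕ} (h : m.degree < k) : coeff m (dividedPower a k) = 0 := by
  rw [dividedPower, coeff_complex_smul, coeff_of_lt_order, smul_zero]
  exact lt_of_lt_of_le (by exact_mod_cast h) (le_order_pow_of_constantCoeff_eq_zero k ha)

/-- The partial sum of the exponential series with `N` terms. -/
def expTrunc {U : Type*} [Ring U] [Algebra ℂ U] (a : U) (N : ℕ) : U :=
  ∑ k ∈ Finset.range N, dividedPower a k

/-- The exponential of a series with vanishing constant coefficient: only the divided powers
`a^(k)` with `k ≤ |m|` contribute to the coefficient at `m`. -/
def mvExp (a : MvPowerSeries σ R) : MvPowerSeries σ R :=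
  fun m => coeff m (expTrunc a (m.degree + 1))

theorem coeff_mvExp {a : MvPowerSeries σ R} (ha : constantCoeff a = 0) {N : ℕ} {m : σ →₀ ℕ}
    (h : m.degree < N) : coeff m (mvExp a) = coeff m (expTrunc a N) := by
  change coeff m (expTrunc a (m.degree + 1)) = _
  rw [expTrunc, expTrunc, map_sum, map_sum]
  refine Finset.sum_subset (Finset.range_subset_range.mpr h) fun k _ hk => ?_
  exact coeff_dividedPower_eq_zero ha (by simpa using hk)

theorem coeff_mvExp_of_le {a : MvPowerSeries σ R} (ha : constantCoeff a = 0) {N : ℕ}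
    {m n : σ →₀ ℕ} (h : m.degree < N) (hn : n ≤ m) :
    coeff n (mvExp a) = coeff n (expTrunc a N) :=
  coeff_mvExp ha ((Finsupp.degree_mono hn).trans_lt h)

/-- With `b₁ = [a, b]` and `b₂ = [a, b₁] / 2`, the divided powers of `a` move past `b` by a Leibniz
rule that stops after three terms. -/
theorem dividedPower_mul_of_ad_nilpotent {U : Type*} [Ring U] [Algebra ℂ U] {a b b₁ b₂ : U}
    (h : a * b = b * a + b₁) (h₁ : a * b₁ = b₁ * a + 2 • b₂) (h₂ : a * b₂ = b₂ * a) (n : ℕ) :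
    dividedPower a (n + 2) * b =
      b * dividedPower a (n + 2) + b₁ * dividedPower a (n + 1) + b₂ * dividedPower a n := by
  have inj : ∀ (k : ℕ) {x y : U}, (k + 1) • x = (k + 1) • y → x = y := fun k x y hxy => by
    rw [← Nat.cast_smul_eq_nsmul ℂ, ← Nat.cast_smul_eq_nsmul ℂ] at hxy
    exact smul_right_injective U (Nat.cast_ne_zero.mpr (by omega)) hxy
  have h2 := succ_nsmul_dividedPower_succ a
  induction n with
  | zero =>
    refine inj 1 ?_
    have h3 : (1 + 1) • dividedPower a (0 + 2) = a * a := by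
      rw [h2 1]; simp [dividedPower]
    have h4 : dividedPower a (0 + 1) = a := by simp [dividedPower]
    rw [smul_add, smul_add, ← smul_mul_assoc, ← mul_smul_comm (1 + 1) b, h3, h4,
      dividedPower_zero_right, mul_assoc, h, mul_add, h₁, ← mul_assoc, h]
    noncomm_ring
  | succ n ih =>
    refine inj (n + 2) ?_
    rw [smul_add, smul_add, ← smul_mul_assoc, ← mul_smul_comm (n + 2 + 1) b, h2 (n + 2), mul_assoc,
      ih, mul_add, mul_add, ← mul_assoc a, ← mul_assoc a, ← mul_assoc a, h, h₁, h₂, add_mul,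
      add_mul, mul_assoc b₁ a, mul_assoc b₂ a, ← h2, ← h2 n]
    simp only [mul_smul_comm, smul_mul_assoc, mul_assoc]
    module

/-- Conjugation by an exponential, `exp a · b = (exp (ad a) b) · exp a`, when `(ad a)³ b = 0`. -/
theorem mvExp_mul {a b b₁ b₂ : MvPowerSeries σ R} (ha : constantCoeff a = 0)
    (h : a * b = b * a + b₁) (h₁ : a * b₁ = b₁ * a + 2 • b₂) (h₂ : a * b₂ = b₂ * a) :
    mvExp a * b = (b + b₁ + b₂) * mvExp a := by
  have key : ∀ N, expTrunc a (N + 2) * b =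
      b * expTrunc a (N + 2) + b₁ * expTrunc a (N + 1) + b₂ * expTrunc a N := by
    intro N
    induction N with
    | zero =>
      have h1 : dividedPower a 1 = a := by simp [dividedPower]
      simp [expTrunc, Finset.sum_range_succ, h1, add_mul, h, mul_add, add_assoc]
    | succ N ih =>
      have hs : ∀ M, expTrunc a (M + 1) = expTrunc a M + dividedPower a M := fun M =>
        Finset.sum_range_succ _ _
      rw [hs (N + 1 + 1), hs (N + 1), hs N, add_mul, ← hs N, ← hs (N + 1), ih,
        dividedPower_mul_of_ad_nilpotent h h₁ h₂]
      rw [hs (N + 1), hs N]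
      noncomm_ring
  ext m
  have h0 : ∀ (c : MvPowerSeries σ R) (i : ℕ),
      coeff m (c * mvExp a) = coeff m (c * expTrunc a (m.degree + 1 + i)) := fun c i =>
    coeff_mul_congr (fun _ _ => rfl) fun n hn => coeff_mvExp_of_le ha (by omega) hn
  have h0' : coeff m (mvExp a * b) = coeff m (expTrunc a (m.degree + 1 + 2) * b) :=
    coeff_mul_congr (fun n hn => coeff_mvExp_of_le ha (by omega) hn) fun _ _ => rfl
  rw [add_mul, add_mul, map_add, map_add, h0 b 2, h0 b₁ 1, h0 b₂ 0, h0', key, map_add, map_add]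

theorem mvExp_mul_of_commute {a b : MvPowerSeries σ R} (ha : constantCoeff a = 0)
    (h : Commute a b) : mvExp a * b = b * mvExp a := by
  simpa using mvExp_mul (b₁ := 0) (b₂ := 0) ha (by simpa using h.eq) (by simp) (by simp)

theorem euler_mvExp {a : MvPowerSeries σ R} (ha : constantCoeff a = 0)
    (h : Commute (euler w a) a) : euler w (mvExp a) = euler w a * mvExp a := by
  have key : ∀ N, euler w (expTrunc a (N + 1)) = euler w a * expTrunc a N := by
    intro N
    induction N with
    | zero => simp [expTrunc]
    | succ N ih =>
      rw [expTrunc, Finset.sum_range_succ, map_add, ← expTrunc, ih, euler_dividedPower_succ w h,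
        ← mul_add, expTrunc, expTrunc, Finset.sum_range_succ]
  ext m
  have h1 : coeff m (euler w a * mvExp a) = coeff m (euler w a * expTrunc a (m.degree + 1)) :=
    coeff_mul_congr (fun _ _ => rfl) fun n hn => coeff_mvExp_of_le ha (by omega) hn
  rw [h1, ← key, coeff_euler, coeff_euler, coeff_mvExp ha (N := m.degree + 1 + 1) (by omega)]

@[simp]
theorem mvExp_zero : mvExp (0 : MvPowerSeries σ R) = 1 := by
  ext m
  change coeff m (expTrunc 0 (m.degree + 1)) = _
  rw [expTrunc, Finset.sum_range_succ', dividedPower_zero_right, Finset.sum_eq_zero, zero_add]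
  intro k _
  simp [dividedPower]

theorem weightZero_mvExp (a : MvPowerSeries σ R) :
    weightZero w (mvExp a) = mvExp (weightZero w a) := by
  ext m
  change (if w m = 0 then coeff m (expTrunc a (m.degree + 1)) else 0) =
    coeff m (expTrunc (weightZero w a) (m.degree + 1))
  rw [← coeff_weightZero]
  congr 1
  rw [expTrunc, expTrunc, map_sum]
  refine Finset.sum_congr rfl fun k _ => ?_
  rw [dividedPower, dividedPower, ← map_pow]
  ext n
  rw [coeff_weightZero, coeff_complex_smul, coeff_complex_smul, coeff_weightZero]
  split_ifs <;> simp

/-- Both sides solve the same equation for the Euler operator of the total degree. -/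
theorem mvExp_mul_mvExp_neg {a : MvPowerSeries σ R} (ha : constantCoeff a = 0)
    (h : Commute (euler Finsupp.degree a) a) : mvExp a * mvExp (-a) = 1 := by
  have ha' : constantCoeff (-a) = 0 := by rw [map_neg, ha, neg_zero]
  refine eq_of_euler_eq_mul Finsupp.degree (u := 0) (map_zero _) ?_ (by simp) ?_
  · rw [euler_mul, euler_mvExp _ ha h, euler_mvExp _ ha' (by simpa using h), zero_mul, map_neg,
      ← mvExp_mul_of_commute ha h.symm]
    noncomm_ring
  · have h0 : weightZero Finsupp.degree a = 0 := by
      ext m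
      rw [coeff_weightZero]
      split_ifs with hm
      · rw [Finsupp.degree_eq_zero_iff] at hm
        rw [hm, coeff_zero_eq_constantCoeff_apply, ha, map_zero]
      · simp
    rw [map_mul, weightZero_mvExp, weightZero_mvExp, map_neg, h0, neg_zero, mvExp_zero, map_one,
      one_mul]

theorem mvExp_mem_seriesSubring {Z : Subring R} {s : Set σ} {a : MvPowerSeries σ R}
    (h : HasDividedPowers (seriesSubring Z s) a) : mvExp a ∈ seriesSubring Z s := by
  intro m hm
  change coeff m (expTrunc a (m.degree + 1)) ∈ Z
  rw [expTrunc, map_sum]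
  exact Z.sum_mem fun k _ => h k m hm

end Exponential

/-! ### Coefficientwise maps -/

section CoeffMap

open MvPowerSeries

variable {σ C R : Type*} [Ring C] [Ring R]

/-- The extension of an additive map to power series, coefficient by coefficient. -/
def coeffMap (l : C →+ R) : MvPowerSeries σ C →+ MvPowerSeries σ R where
  toFun a m := l (a m)
  map_zero' := by
    ext m
    exact map_zero l
  map_add' a b := by
    ext m
    exact map_add l _ _

theorem coeff_coeffMap (l : C →+ R) (a : MvPowerSeries σ C) (m : σ →₀ ℕ) :
    coeff m (coeffMap l a) = l (coeff m a) := rfl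

theorem constantCoeff_coeffMap (l : C →+ R) {a : MvPowerSeries σ C} (ha : constantCoeff a = 0) :
    constantCoeff (coeffMap l a) = 0 := by
  rw [← coeff_zero_eq_constantCoeff_apply] at ha ⊢
  rw [coeff_coeffMap, ha, map_zero]

theorem euler_coeffMap (w : (σ →₀ ℕ) →+ ℕ) (l : C →+ R) (a : MvPowerSeries σ C) :
    euler w (coeffMap l a) = coeffMap l (euler w a) := by
  ext m
  rw [coeff_euler, coeff_coeffMap, coeff_coeffMap, coeff_euler, map_nsmul]

theorem weightZero_coeffMap (w : (σ →₀ ℕ) →+ ℕ) (l : C →+ R) (a : MvPowerSeries σ C) :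
    weightZero w (coeffMap l a) = coeffMap l (weightZero w a) := by
  ext m
  rw [coeff_weightZero, coeff_coeffMap, coeff_coeffMap, coeff_weightZero]
  split_ifs <;> simp

theorem coeffMap_mul_eq {C : Type*} [CommRing C] {l₁ l₂ l₃ : C →+ R}
    (h : ∀ a b, l₁ a * l₂ b = l₂ b * l₁ a + l₃ (a * b)) (a b : MvPowerSeries σ C) :
    coeffMap l₁ a * coeffMap l₂ b = coeffMap l₂ b * coeffMap l₁ a + coeffMap l₃ (a * b) := by
  classical
  ext m
  rw [map_add, coeff_coeffMap, coeff_mul, coeff_mul, coeff_mul, map_sum,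
    ← Finsupp.sum_antidiagonal_swap m fun i j => coeff j (coeffMap l₂ b) * coeff i (coeffMap l₁ a),
    ← Finset.sum_add_distrib]
  exact Finset.sum_congr rfl fun ij _ => h _ _

end CoeffMap

/-! ### Exponentials in the current algebra of `𝔰𝔩₂` -/

section CurrentSl2

open MvPowerSeries

/-- The additive maps `a ↦ x⁺ ⊗ a`, `a ↦ x⁻ ⊗ a`, `a ↦ h ⊗ a` from `C` to `Q` satisfy the
commutation relations of `𝔰𝔩₂ ⊗ C`, except that the `h ⊗ a` need not commute with one another. -/
structure IsCurrentSl2 {C Q : Type*} [CommRing C] [Ring Q] (e f h : C →+ Q) : Prop where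
  e_mul_f (a b : C) : e a * f b = f b * e a + h (a * b)
  h_mul_e (a b : C) : h a * e b = e b * h a + (2 • e) (a * b)
  h_mul_f (a b : C) : h a * f b = f b * h a + (-(2 • f)) (a * b)
  e_comm (a b : C) : Commute (e a) (e b)
  f_comm (a b : C) : Commute (f a) (f b)

variable {σ C R : Type*} [CommRing C] [Ring R] {e f h : C →+ R}

theorem IsCurrentSl2.series (t : IsCurrentSl2 e f h) :
    IsCurrentSl2 (coeffMap (σ := σ) e) (coeffMap f) (coeffMap h) where
  e_mul_f := coeffMap_mul_eq t.e_mul_f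
  h_mul_e a b := by
    rw [coeffMap_mul_eq t.h_mul_e]
    rfl
  h_mul_f a b := by
    rw [coeffMap_mul_eq t.h_mul_f]
    rfl
  e_comm a b := commute_of_coeff fun _ _ => t.e_comm _ _
  f_comm a b := commute_of_coeff fun _ _ => t.f_comm _ _

variable [Algebra ℂ R]

section Conjugation

variable {e f h : C →+ MvPowerSeries σ R} (t : IsCurrentSl2 e f h)
include t

theorem IsCurrentSl2.mvExp_e_mul_h {a : C} (ha : constantCoeff (e a) = 0) (b : C) :
    mvExp (e a) * h b = (h b - 2 • e (a * b)) * mvExp (e a) := by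
  rw [mvExp_mul (b₁ := -(2 • e (a * b))) (b₂ := 0) ha, add_zero, sub_eq_add_neg]
  · rw [t.h_mul_e, mul_comm b, AddMonoidHom.nsmul_apply]
    abel
  · simp [(t.e_comm a (a * b)).eq, mul_add, add_mul, two_smul]
  · simp

theorem IsCurrentSl2.mvExp_e_mul_f {a : C} (ha : constantCoeff (e a) = 0) (b : C) :
    mvExp (e a) * f b = (f b + h (a * b) - e (a * (a * b))) * mvExp (e a) := by
  rw [mvExp_mul (b₁ := h (a * b)) (b₂ := -e (a * (a * b))) ha, sub_eq_add_neg]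
  · exact t.e_mul_f a b
  · rw [t.h_mul_e, mul_comm (a * b), AddMonoidHom.nsmul_apply, smul_neg]
    abel
  · rw [mul_neg, neg_mul, (t.e_comm _ _).eq]

theorem IsCurrentSl2.mvExp_f_mul_h {a : C} (ha : constantCoeff (f a) = 0) (b : C) :
    mvExp (f a) * h b = (h b + 2 • f (a * b)) * mvExp (f a) := by
  rw [mvExp_mul (b₁ := 2 • f (a * b)) (b₂ := 0) ha, add_zero]
  · rw [t.h_mul_f, mul_comm b, AddMonoidHom.neg_apply, AddMonoidHom.nsmul_apply]
    abel
  · simp [(t.f_comm a (a * b)).eq, mul_add, add_mul, two_smul]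
  · simp

theorem IsCurrentSl2.mvExp_f_mul_e {a : C} (ha : constantCoeff (f a) = 0) (b : C) :
    mvExp (f a) * e b = (e b - h (a * b) - f (a * (a * b))) * mvExp (f a) := by
  rw [mvExp_mul (b₁ := -h (a * b)) (b₂ := -f (a * (a * b))) ha, sub_eq_add_neg, sub_eq_add_neg]
  · rw [t.e_mul_f, mul_comm b]
    abel
  · rw [neg_mul, t.h_mul_f, mul_comm (a * b), AddMonoidHom.neg_apply, AddMonoidHom.nsmul_apply,
      smul_neg, mul_neg]
    abel
  · rw [mul_neg, neg_mul, (t.f_comm _ _).eq]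

/-- The product of the three exponentials represents an upper triangular matrix with diagonal
entries `g⁻¹`, `g`, so that conjugation by it rescales `x⁺` by `g⁻² = (1 - ST)²`. -/
theorem IsCurrentSl2.mvExp_prod_mul_e {S T g : C} (hg : g = 1 + S * T * g)
    (he : constantCoeff (e S) = 0) (hf : constantCoeff (f (-T)) = 0)
    (hfg : constantCoeff (f (T * g)) = 0) :
    mvExp (f (T * g)) * mvExp (e S) * mvExp (f (-T)) * e (S * g ^ 2) =
      e S * (mvExp (f (T * g)) * mvExp (e S) * mvExp (f (-T))) := by
  have h3 : mvExp (f (-T)) * e (S * g ^ 2) =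
      (e (S * g ^ 2) + h (S * T * g ^ 2) - f (S * T * T * g ^ 2)) * mvExp (f (-T)) := by
    rw [t.mvExp_f_mul_e hf, show -T * (S * g ^ 2) = -(S * T * g ^ 2) by ring,
      show -T * -(S * T * g ^ 2) = S * T * T * g ^ 2 by ring, map_neg, sub_neg_eq_add]
  have h2 : mvExp (e S) * (e (S * g ^ 2) + h (S * T * g ^ 2) - f (S * T * T * g ^ 2)) =
      (e S + h (S * T * g) - f (S * T * T * g ^ 2)) * mvExp (e S) := by
    rw [mul_sub, mul_add, mvExp_mul_of_commute he (t.e_comm _ _), t.mvExp_e_mul_h he,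
      t.mvExp_e_mul_f he, ← add_mul, ← sub_mul]
    congr 1
    -- The coefficients combine by means of `g (1 - ST) = 1`.
    have e1 : e S = e (S * g ^ 2) - 2 • e (S * (S * T * g ^ 2)) +
        e (S * (S * (S * T * T * g ^ 2))) := by
      rw [← map_nsmul, ← map_sub, ← map_add]
      congr 1
      linear_combination (-S * (g - S * T * g + 1)) * hg
    have e2 : h (S * T * g) = h (S * T * g ^ 2) - h (S * (S * T * T * g ^ 2)) := by
      rw [← map_sub]
      congr 1
      linear_combination (-S * T * g) * hg
    rw [e1, e2]
    abel
  have h1 : mvExp (f (T * g)) * (e S + h (S * T * g) - f (S * T * T * g ^ 2)) =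
      e S * mvExp (f (T * g)) := by
    rw [mul_sub, mul_add, mvExp_mul_of_commute hfg (t.f_comm _ _), t.mvExp_f_mul_h hfg,
      t.mvExp_f_mul_e hfg, ← add_mul, ← sub_mul]
    congr 1
    rw [show T * g * (S * T * g) = S * T * T * g ^ 2 by ring,
      show T * g * (T * g * S) = S * T * T * g ^ 2 by ring,
      show T * g * S = S * T * g by ring]
    abel
  rw [mul_assoc _ _ (e _), h3, ← mul_assoc, mul_assoc _ _ (_ - _), h2, ← mul_assoc, h1]
  simp only [mul_assoc]

end Conjugation

/-- The factorization of the torus element: if `g = (1 - ST)⁻¹`, then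
`exp(h ⊗ log(1 - ST)) = exp(x⁻ ⊗ Tg) exp(x⁺ ⊗ S) exp(-x⁻ ⊗ T) exp(-x⁺ ⊗ Sg)`. The left-hand side
enters through the differential equation in the weight of `S` that characterizes it. -/
theorem IsCurrentSl2.eq_mvExp_prod (t : IsCurrentSl2 e f h) (w : (σ →₀ ℕ) →+ ℕ)
    {S T g : MvPowerSeries σ C} (hg : g = 1 + S * T * g)
    (hS : constantCoeff S = 0) (hT : constantCoeff T = 0)
    (hwS : euler w S = S) (hwT : euler w T = 0) (hS0 : weightZero w S = 0)
    {P : MvPowerSeries σ R} (hP : euler w P = -coeffMap h (S * T * g) * P)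
    (hP0 : weightZero w P = 1) :
    P = mvExp (coeffMap f (T * g)) * mvExp (coeffMap e S) * mvExp (coeffMap f (-T)) *
      mvExp (coeffMap e (-(S * g))) := by
  have t' : IsCurrentSl2 (coeffMap (σ := σ) e) (coeffMap f) (coeffMap h) := t.series
  have ce : constantCoeff (coeffMap e S) = 0 := constantCoeff_coeffMap e hS
  have cf : constantCoeff (coeffMap f (-T)) = 0 :=
    constantCoeff_coeffMap f (by rw [map_neg, hT, neg_zero])
  have cfg : constantCoeff (coeffMap f (T * g)) = 0 :=
    constantCoeff_coeffMap f (by rw [map_mul, hT, zero_mul])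
  have ceg : constantCoeff (coeffMap e (-(S * g))) = 0 :=
    constantCoeff_coeffMap e (by rw [map_neg, map_mul, hS, zero_mul, neg_zero])
  have hwg : euler w g = S * T * g ^ 2 := by
    have h1 : euler w g = S * T * g + S * T * euler w g := by
      conv_lhs => rw [hg]
      rw [map_add, euler_one, zero_add, euler_mul, euler_mul, hwS, hwT, mul_zero, add_zero]
    linear_combination g * h1 - euler w g * hg
  refine eq_of_euler_eq_mul w (u := -coeffMap h (S * T * g)) ?_ hP ?_ ?_
  · rw [map_neg, weightZero_coeffMap, map_mul (weightZero w), map_mul (weightZero w), hS0,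
      zero_mul, zero_mul, map_zero, neg_zero]
  · have d1 : euler w (mvExp (coeffMap f (T * g))) =
        coeffMap f (S * T * T * g ^ 2) * mvExp (coeffMap f (T * g)) := by
      rw [euler_mvExp w cfg (by rw [euler_coeffMap]; exact t'.f_comm _ _), euler_coeffMap,
        euler_mul, hwT, hwg]
      congr 2
      ring
    have d2 : euler w (mvExp (coeffMap e S)) = coeffMap e S * mvExp (coeffMap e S) := by
      rw [euler_mvExp w ce (by rw [euler_coeffMap]; exact t'.e_comm _ _), euler_coeffMap, hwS]
    have d3 : euler w (mvExp (coeffMap f (-T))) = 0 := by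
      rw [euler_mvExp w cf (by rw [euler_coeffMap]; exact t'.f_comm _ _), euler_coeffMap, map_neg,
        hwT, neg_zero, map_zero, zero_mul]
    have d4 : euler w (mvExp (coeffMap e (-(S * g)))) =
        -(coeffMap e (S * g ^ 2) * mvExp (coeffMap e (-(S * g)))) := by
      rw [euler_mvExp w ceg (by rw [euler_coeffMap]; exact t'.e_comm _ _), euler_coeffMap,
        map_neg (euler w), euler_mul, hwS, hwg, map_neg (coeffMap e), neg_mul]
      congr 4
      linear_combination (-S * g) * hg
    rw [euler_mul, d4, mul_neg, ← mul_assoc, t'.mvExp_prod_mul_e hg ce cf cfg, euler_mul, d3,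
      mul_zero, add_zero, euler_mul, d1, d2, ← mul_assoc (mvExp (coeffMap f (T * g))),
      t'.mvExp_f_mul_e cfg, show T * g * (T * g * S) = S * T * T * g ^ 2 by ring,
      show T * g * S = S * T * g by ring]
    noncomm_ring
  · rw [hP0, map_mul, map_mul, map_mul, weightZero_mvExp, weightZero_mvExp, weightZero_mvExp,
      weightZero_mvExp]
    simp only [weightZero_coeffMap]
    have hg0 : weightZero w g = 1 := by
      rw [hg, map_add, map_mul, map_mul, hS0, zero_mul, zero_mul, add_zero, map_one]
    rw [map_mul (weightZero w), map_neg (weightZero w), map_neg (weightZero w),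
      map_mul (weightZero w), hS0, hg0, zero_mul, neg_zero, map_zero, mvExp_zero,
      mul_one, mul_one, mul_one, map_neg, mvExp_mul_mvExp_neg]
    · refine constantCoeff_coeffMap f ?_
      rw [← coeff_zero_eq_constantCoeff_apply] at hT ⊢
      rw [coeff_weightZero, hT, ite_self]
    · rw [euler_coeffMap]
      exact t'.f_comm _ _

end CurrentSl2

/-! ### Linear power series -/

section LinearSeries

open MvPowerSeries

variable {σ R : Type*} [Ring R]

/-- The series `∑ i, vᵢ Xᵢ`. -/
def linearSeries (v : σ → R) : MvPowerSeries σ R :=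
  fun m => ∑ i ∈ m.support, coeff m (monomial (Finsupp.single i 1) (v i))

theorem coeff_linearSeries (v : σ → R) (m : σ →₀ ℕ) : coeff m (linearSeries v) =
    ∑ i ∈ m.support, coeff m (monomial (Finsupp.single i 1) (v i)) := rfl

theorem coeff_linearSeries_eq_zero_or (v : σ → R) (m : σ →₀ ℕ) :
    coeff m (linearSeries v) = 0 ∨
      ∃ i, m = Finsupp.single i 1 ∧ coeff m (linearSeries v) = v i := by
  classical
  by_cases h : ∃ i, m = Finsupp.single i 1
  · obtain ⟨i, rfl⟩ := h
    refine Or.inr ⟨i, rfl, ?_⟩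
    rw [coeff_linearSeries, Finsupp.support_single _ one_ne_zero, Finset.sum_singleton,
      coeff_monomial_same]
  · push Not at h
    refine Or.inl (Finset.sum_eq_zero fun i _ => ?_)
    exact coeff_monomial_ne (h i) _

theorem constantCoeff_linearSeries (v : σ → R) : constantCoeff (linearSeries v) = 0 := by
  rw [← coeff_zero_eq_constantCoeff_apply, coeff_linearSeries, Finsupp.support_zero,
    Finset.sum_empty]

theorem coeff_linearSeries_mul (v : σ → R) (f : MvPowerSeries σ R) (m : σ →₀ ℕ) :
    coeff m (linearSeries v * f) =
      ∑ i ∈ m.support, v i * coeff (m - Finsupp.single i 1) f := by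
  classical
  have h : coeff m (linearSeries v * f) =
      coeff m ((∑ i ∈ m.support, monomial (Finsupp.single i 1) (v i)) * f) := by
    refine coeff_mul_congr (fun n hn => ?_) fun _ _ => rfl
    rw [coeff_linearSeries, map_sum]
    refine Finset.sum_subset (Finsupp.support_mono hn) fun i _ hi => coeff_monomial_ne ?_ _
    rintro rfl
    simp at hi
  rw [h, Finset.sum_mul, map_sum]
  refine Finset.sum_congr rfl fun i hi => ?_
  rw [coeff_monomial_mul, if_pos]
  rw [Finsupp.single_le_iff]
  exact Nat.one_le_iff_ne_zero.mpr (Finsupp.mem_support_iff.mp hi)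

end LinearSeries

/-! ### Two groups of variables -/

section Bivariate

open MvPowerSeries

variable {A R : Type*} [Ring R]

theorem exists_eq_sumElim (m : A ⊕ A →₀ ℕ) : ∃ φ χ : FMultiset A, m = φ.sumElim χ :=
  ⟨_, _, (Finsupp.comapDomain_sumElim_comapDomain m).symm⟩

theorem sumElim_inj {φ χ φ' χ' : FMultiset A} :
    φ.sumElim χ = φ'.sumElim χ' ↔ φ = φ' ∧ χ = χ' := by
  refine ⟨fun h => ?_, by rintro ⟨rfl, rfl⟩; rfl⟩
  have h1 := congrArg (fun x => x.comapDomain Sum.inl Sum.inl_injective.injOn) h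
  have h2 := congrArg (fun x => x.comapDomain Sum.inr Sum.inr_injective.injOn) h
  simp only [Finsupp.comapDomain_inl_sumElim, Finsupp.comapDomain_inr_sumElim] at h1 h2
  exact ⟨h1, h2⟩

theorem sumElim_eq_zero {φ χ : FMultiset A} : φ.sumElim χ = 0 ↔ φ = 0 ∧ χ = 0 := by
  rw [← Finsupp.sumElim_zero_zero, sumElim_inj]

/-- The product of series in two groups of variables, as a sum over pairs of submultisets. -/
theorem coeff_sumElim_mul (f g : MvPowerSeries (A ⊕ A) R) (φ χ : FMultiset A) :
    coeff (φ.sumElim χ) (f * g) = ∑ ψ₁ ∈ sub φ, ∑ ψ₂ ∈ sub χ,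
      coeff (ψ₁.sumElim ψ₂) f * coeff ((φ - ψ₁).sumElim (χ - ψ₂)) g := by
  classical
  rw [coeff_mul, ← Finset.sum_product']
  symm
  refine Finset.sum_bij (fun ψ _ => (ψ.1.sumElim ψ.2, (φ - ψ.1).sumElim (χ - ψ.2))) ?_ ?_ ?_ ?_
  · intro ψ hψ
    rw [Finset.mem_product, mem_sub, mem_sub] at hψ
    rw [mem_antidiagonal, ← Finsupp.sumElim_add, add_tsub_cancel_of_le hψ.1,
      add_tsub_cancel_of_le hψ.2]
  · intro ψ _ ψ' _ h
    obtain ⟨h1, h2⟩ := sumElim_inj.mp (congrArg Prod.fst h)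
    exact Prod.ext h1 h2
  · rintro ⟨m, n⟩ h
    obtain ⟨φ₁, χ₁, rfl⟩ := exists_eq_sumElim m
    obtain ⟨φ₂, χ₂, rfl⟩ := exists_eq_sumElim n
    rw [mem_antidiagonal, ← Finsupp.sumElim_add, sumElim_inj] at h
    obtain ⟨rfl, rfl⟩ := h
    refine ⟨(φ₁, χ₁), ?_, ?_⟩
    · rw [Finset.mem_product, mem_sub, mem_sub]
      exact ⟨le_self_add, le_self_add⟩
    · simp
  · intros
    rfl

/-- The degree `|φ|` of `s^φ t^χ` in the first group of variables. -/
def leftDegree : (A ⊕ A →₀ ℕ) →+ ℕ :=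
  Finsupp.degree.comp (Finsupp.comapDomain.addMonoidHom Sum.inl_injective)

@[simp]
theorem leftDegree_sumElim (φ χ : FMultiset A) : leftDegree (φ.sumElim χ) = φ.degree := by
  rw [leftDegree, AddMonoidHom.comp_apply, Finsupp.comapDomain.addMonoidHom_apply,
    Finsupp.comapDomain_inl_sumElim]

theorem leftDegree_single_inl (a : A) : leftDegree (Finsupp.single (Sum.inl a) 1) = 1 := by
  rw [← Finsupp.sumElim_single_zero, leftDegree_sumElim, Finsupp.degree_single]

theorem leftDegree_single_inr (a : A) : leftDegree (Finsupp.single (Sum.inr a) 1) = 0 := by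
  rw [← Finsupp.sumElim_zero_single, leftDegree_sumElim, map_zero]

theorem sum_support_sumElim {M : Type*} [AddCommMonoid M] (φ χ : FMultiset A) (F : A ⊕ A → M) :
    ∑ i ∈ (φ.sumElim χ).support, F i =
      ∑ a ∈ φ.support, F (Sum.inl a) + ∑ a ∈ χ.support, F (Sum.inr a) := by
  rw [← Finset.sum_disjSum]
  rfl

theorem coeff_linearSeries_inl_mul (v : A → R) (f : MvPowerSeries (A ⊕ A) R)
    (φ χ : FMultiset A) :
    coeff (φ.sumElim χ) (linearSeries (Sum.elim v 0) * f) =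
      ∑ a ∈ φ.support, v a * coeff ((φ - Finsupp.single a 1).sumElim χ) f := by
  rw [coeff_linearSeries_mul, sum_support_sumElim]
  simp only [Sum.elim_inl, Sum.elim_inr, Pi.zero_apply, zero_mul, Finset.sum_const_zero, add_zero]
  refine Finset.sum_congr rfl fun a _ => ?_
  classical
  congr 3
  ext (i | i) <;> simp [Finsupp.single_apply]

theorem coeff_linearSeries_inr_mul (v : A → R) (f : MvPowerSeries (A ⊕ A) R)
    (φ χ : FMultiset A) :
    coeff (φ.sumElim χ) (linearSeries (Sum.elim 0 v) * f) =
      ∑ a ∈ χ.support, v a * coeff (φ.sumElim (χ - Finsupp.single a 1)) f := by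
  rw [coeff_linearSeries_mul, sum_support_sumElim]
  simp only [Sum.elim_inl, Sum.elim_inr, Pi.zero_apply, zero_mul, Finset.sum_const_zero, zero_add]
  refine Finset.sum_congr rfl fun a _ => ?_
  classical
  congr 3
  ext (i | i) <;> simp [Finsupp.single_apply]

end Bivariate

/-! ### Multinomial coefficients -/

section Multinomial

variable {A : Type*}

theorem degree_tsub_single {φ : FMultiset A} {a : A} (ha : a ∈ φ.support) :
    (φ - Finsupp.single a 1).degree + 1 = φ.degree := by
  have h : Finsupp.single a 1 ≤ φ :=
    Finsupp.single_le_iff.mpr (Nat.one_le_iff_ne_zero.mpr (Finsupp.mem_support_iff.mp ha))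
  conv_rhs => rw [← tsub_add_cancel_of_le h]
  rw [map_add, Finsupp.degree_single]

/-- The identity `n · (n - 1)! / (φ - χ_a)! = φ(a) · n! / φ!` with `n = |φ|`. -/
theorem degree_mul_multinomial_tsub_single {φ : FMultiset A} {a : A} (ha : a ∈ φ.support) :
    φ.degree * (φ - Finsupp.single a 1).multinomial = φ a * φ.multinomial := by
  classical
  set θ := φ - Finsupp.single a 1 with hθ
  have hle : Finsupp.single a 1 ≤ φ :=
    Finsupp.single_le_iff.mpr (Nat.one_le_iff_ne_zero.mpr (Finsupp.mem_support_iff.mp ha))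
  have hsub : θ.support ⊆ φ.support := Finsupp.support_mono tsub_le_self
  have h1 := Nat.multinomial_spec φ.support φ
  have h2 := Nat.multinomial_spec φ.support θ
  rw [← Finsupp.multinomial_eq] at h1
  rw [← Finsupp.multinomial_eq_of_support_subset hsub] at h2
  have e1 : ∑ i ∈ φ.support, φ i = φ.degree := rfl
  have e2 : ∑ i ∈ φ.support, θ i = θ.degree :=
    (Finset.sum_subset hsub fun i _ hi => Finsupp.notMem_support_iff.mp hi).symm
  have hd := degree_tsub_single ha
  rw [← hθ] at hd
  rw [e1, ← hd, Nat.factorial_succ, hd] at h1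
  rw [e2] at h2
  rw [← Finset.mul_prod_erase _ _ ha] at h1 h2
  have e3 : ∏ i ∈ φ.support.erase a, (θ i).factorial =
      ∏ i ∈ φ.support.erase a, (φ i).factorial := by
    refine Finset.prod_congr rfl fun i hi => ?_
    rw [hθ, Finsupp.tsub_apply, Finsupp.single_eq_of_ne (Finset.ne_of_mem_erase hi), tsub_zero]
  have e4 : (φ a).factorial = φ a * (θ a).factorial := by
    have : θ a + 1 = φ a := by
      rw [hθ, Finsupp.tsub_apply, Finsupp.single_eq_same]
      have := Finsupp.mem_support_iff.mp ha
      omega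
    rw [← this, Nat.factorial_succ]
  rw [e3] at h2
  rw [e4] at h1
  have hpos : 0 < (θ a).factorial * ∏ i ∈ φ.support.erase a, (φ i).factorial :=
    Nat.mul_pos (Nat.factorial_pos _) (Finset.prod_pos fun i _ => Nat.factorial_pos _)
  refine Nat.eq_of_mul_eq_mul_left hpos ?_
  linear_combination φ.degree * h2 - h1

theorem multinomial_eq_sum {φ : FMultiset A} (h : φ ≠ 0) :
    φ.multinomial = ∑ a ∈ φ.support, (φ - Finsupp.single a 1).multinomial := by
  have hd : 0 < φ.degree := Nat.pos_of_ne_zero (by rwa [Ne, Finsupp.degree_eq_zero_iff])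
  refine Nat.eq_of_mul_eq_mul_left hd ?_
  rw [Finset.mul_sum, Finset.sum_congr rfl fun a ha => degree_mul_multinomial_tsub_single ha,
    ← Finset.sum_mul]
  rfl

end Multinomial

/-! ### The series `(1 - ST)⁻¹` -/

section Geometric

open MvPowerSeries

variable {A : Type*} [CommRing A]

/-- The series `S = ∑ a, a s_a` in the first group of variables `s`. -/
def seriesS (A : Type*) [CommRing A] : MvPowerSeries (A ⊕ A) A := linearSeries (Sum.elim id 0)

/-- The series `T = ∑ a, a t_a` in the second group of variables `t`. -/
def seriesT (A : Type*) [CommRing A] : MvPowerSeries (A ⊕ A) A := linearSeries (Sum.elim 0 id)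

/-- The coefficient `𝓜(φ) π(φ)` of `s^φ` in the series `(1 - S)⁻¹`. -/
def geomCoeff (φ : FMultiset A) : A := (φ.multinomial : A) * prodElt φ

/-- The series `(1 - ST)⁻¹`, by its coefficients: the monomial `s^φ t^χ` occurs in `(ST)^n` only for
`n = |φ| = |χ|`. -/
def geomSeries (A : Type*) [CommRing A] : MvPowerSeries (A ⊕ A) A := fun m =>
  let φ : FMultiset A := m.comapDomain Sum.inl Sum.inl_injective.injOn
  let χ : FMultiset A := m.comapDomain Sum.inr Sum.inr_injective.injOn
  if φ.degree = χ.degree then geomCoeff φ * geomCoeff χ else 0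

theorem coeff_geomSeries (φ χ : FMultiset A) : coeff (φ.sumElim χ) (geomSeries A) =
    if φ.degree = χ.degree then geomCoeff φ * geomCoeff χ else 0 := by
  rw [coeff_apply, geomSeries, Finsupp.comapDomain_inl_sumElim, Finsupp.comapDomain_inr_sumElim]

@[simp]
theorem geomCoeff_zero : geomCoeff (0 : FMultiset A) = 1 := by
  simp [geomCoeff, prodElt, Finsupp.multinomial]

theorem mul_prodElt_tsub_single {φ : FMultiset A} {a : A} (ha : a ∈ φ.support) :
    a * prodElt (φ - Finsupp.single a 1) = prodElt φ := by
  have h : Finsupp.single a 1 ≤ φ :=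
    Finsupp.single_le_iff.mpr (Nat.one_le_iff_ne_zero.mpr (Finsupp.mem_support_iff.mp ha))
  conv_rhs => rw [← add_tsub_cancel_of_le h]
  simp [prodElt, Finsupp.prod_add_index', pow_add]

/-- The coefficients of `(1 - S)⁻¹` satisfy the recursion `(1 - S)⁻¹ = 1 + S (1 - S)⁻¹`. -/
theorem geomCoeff_eq_sum {φ : FMultiset A} (h : φ ≠ 0) :
    geomCoeff φ = ∑ a ∈ φ.support, a * geomCoeff (φ - Finsupp.single a 1) := by
  rw [geomCoeff, multinomial_eq_sum h, Nat.cast_sum, Finset.sum_mul]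
  refine Finset.sum_congr rfl fun a ha => ?_
  rw [geomCoeff, mul_left_comm, mul_prodElt_tsub_single ha]

theorem coeff_seriesS_mul (f : MvPowerSeries (A ⊕ A) A) (φ χ : FMultiset A) :
    coeff (φ.sumElim χ) (seriesS A * f) =
      ∑ a ∈ φ.support, a * coeff ((φ - Finsupp.single a 1).sumElim χ) f :=
  coeff_linearSeries_inl_mul id f φ χ

theorem coeff_seriesT_mul (f : MvPowerSeries (A ⊕ A) A) (φ χ : FMultiset A) :
    coeff (φ.sumElim χ) (seriesT A * f) =
      ∑ a ∈ χ.support, a * coeff (φ.sumElim (χ - Finsupp.single a 1)) f :=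
  coeff_linearSeries_inr_mul id f φ χ

/-- The recursions for the coefficients of `(1 - S)⁻¹` and `(1 - T)⁻¹` combine to
`(1 - ST)⁻¹ = 1 + ST (1 - ST)⁻¹`. -/
theorem geomSeries_eq : geomSeries A = 1 + seriesS A * seriesT A * geomSeries A := by
  classical
  ext m
  obtain ⟨φ, χ, rfl⟩ := exists_eq_sumElim m
  rw [map_add, coeff_one, mul_assoc, coeff_seriesS_mul]
  simp only [coeff_seriesT_mul]
  rw [coeff_geomSeries]
  rw [if_congr sumElim_eq_zero rfl rfl]
  have hsum : ∑ a ∈ φ.support, a * ∑ c ∈ χ.support,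
      c * coeff ((φ - Finsupp.single a 1).sumElim (χ - Finsupp.single c 1)) (geomSeries A) =
      if φ.degree = χ.degree then (∑ a ∈ φ.support, a * geomCoeff (φ - Finsupp.single a 1)) *
        ∑ c ∈ χ.support, c * geomCoeff (χ - Finsupp.single c 1) else 0 := by
    have hterm : ∀ a ∈ φ.support, ∀ c ∈ χ.support,
        coeff ((φ - Finsupp.single a 1).sumElim (χ - Finsupp.single c 1)) (geomSeries A) =
          if φ.degree = χ.degree then
            geomCoeff (φ - Finsupp.single a 1) * geomCoeff (χ - Finsupp.single c 1) else 0 := by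
      intro a ha c hc
      rw [coeff_geomSeries]
      refine if_congr ?_ rfl rfl
      rw [← degree_tsub_single ha, ← degree_tsub_single hc]
      omega
    rw [Finset.sum_congr rfl fun a ha => by
      rw [Finset.sum_congr rfl fun c hc => by rw [hterm a ha c hc]]]
    split_ifs
    · rw [Finset.sum_mul_sum]
      refine Finset.sum_congr rfl fun a _ => ?_
      rw [Finset.mul_sum]
      exact Finset.sum_congr rfl fun c _ => by ring
    · simp
  rw [hsum]
  by_cases hφ : φ = 0
  · by_cases hχ : χ = 0
    · simp [hφ, hχ]
    · have : χ.degree ≠ 0 := by rwa [Ne, Finsupp.degree_eq_zero_iff]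
      simp [hφ, hχ, this.symm]
  · by_cases hχ : χ = 0
    · have : φ.degree ≠ 0 := by rwa [Ne, Finsupp.degree_eq_zero_iff]
      simp [hφ, hχ, this]
    · rw [geomCoeff_eq_sum hφ, geomCoeff_eq_sum hχ]
      simp [hφ]

theorem euler_seriesS : euler leftDegree (seriesS A) = seriesS A := by
  ext m
  rw [coeff_euler]
  rcases coeff_linearSeries_eq_zero_or (Sum.elim id 0 : A ⊕ A → A) m with h | ⟨a | a, rfl, h⟩
  · rw [seriesS, h, smul_zero]
  · rw [leftDegree_single_inl, one_smul]
  · rw [seriesS, h, Sum.elim_inr, Pi.zero_apply, smul_zero]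

theorem euler_seriesT : euler leftDegree (seriesT A) = 0 := by
  ext m
  rw [coeff_euler, coeff_zero]
  rcases coeff_linearSeries_eq_zero_or (Sum.elim 0 id : A ⊕ A → A) m with h | ⟨a | a, rfl, h⟩
  · rw [seriesT, h, smul_zero]
  · rw [seriesT, h, Sum.elim_inl, Pi.zero_apply, smul_zero]
  · rw [leftDegree_single_inr, zero_smul]

theorem weightZero_seriesS : weightZero leftDegree (seriesS A) = 0 := by
  ext m
  rw [← euler_seriesS, coeff_weightZero, coeff_euler, coeff_zero]
  split_ifs with h
  · rw [h, zero_smul]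
  · rfl

end Geometric

/-! ### The commutation relations in `U(𝔰𝔩₂ ⊗ A)` -/

section Relations

attribute [local instance 100] LieRing.ofAssociativeRing

variable {A : Type*} [CommRing A] [Algebra ℂ A]

/-- The additive map `a ↦ z ⊗ a` from `A` to `U(𝔞 ⊗ A)`. -/
def eltHom {𝔞 : Type*} [LieRing 𝔞] [LieAlgebra ℂ 𝔞] (z : 𝔞) : A →+ UMap A 𝔞 where
  toFun a := elt z a
  map_zero' := by rw [elt, TensorProduct.zero_tmul, map_zero]
  map_add' a b := by rw [elt, TensorProduct.add_tmul, map_add]; rfl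

theorem eltHom_apply {𝔞 : Type*} [LieRing 𝔞] [LieAlgebra ℂ 𝔞] (z : 𝔞) (a : A) :
    eltHom z a = elt z a := rfl

/-- The bracket of `𝔞 ⊗ A`, as a commutation relation in `U(𝔞 ⊗ A)`. -/
theorem elt_mul_elt {𝔞 : Type*} [LieRing 𝔞] [LieAlgebra ℂ 𝔞] (z z' : 𝔞) (a b : A) :
    elt z a * elt z' b = elt z' b * elt z a + elt ⁅z, z'⁆ (a * b) := by
  have h := LieHom.map_lie (UniversalEnvelopingAlgebra.ι ℂ : MapAlgebra A 𝔞 →ₗ⁅ℂ⁆ _)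
    (a ⊗ₜ[ℂ] z) (b ⊗ₜ[ℂ] z')
  rw [LieAlgebra.ExtendScalars.bracket_tmul, LieRing.of_associative_ring_bracket] at h
  rw [elt, elt, elt, h]
  abel

theorem elt_smul {𝔞 : Type*} [LieRing 𝔞] [LieAlgebra ℂ 𝔞] (c : ℂ) (z : 𝔞) (a : A) :
    elt (c • z) a = c • elt z a := by
  rw [elt, TensorProduct.tmul_smul, map_smul, elt]

theorem lie_xPlus_xMinus : ⁅xPlus, xMinus⁆ = hElt := by
  ext i j
  fin_cases i <;> fin_cases j <;>
    simp [xPlus, xMinus, hElt, LieRing.of_associative_ring_bracket]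

theorem lie_hElt_xPlus : ⁅hElt, xPlus⁆ = (2 : ℂ) • xPlus := by
  ext i j
  fin_cases i <;> fin_cases j <;>
    simp [xPlus, hElt, LieRing.of_associative_ring_bracket, sub_mul, mul_sub, one_add_one_eq_two]

theorem lie_hElt_xMinus : ⁅hElt, xMinus⁆ = (-2 : ℂ) • xMinus := by
  have h : (-1 - 1 : ℂ) = -2 := by norm_num
  ext i j
  fin_cases i <;> fin_cases j <;>
    simp [xMinus, hElt, LieRing.of_associative_ring_bracket, h]

theorem commute_elt {𝔞 : Type*} [LieRing 𝔞] [LieAlgebra ℂ 𝔞] (z : 𝔞) (a b : A) :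
    Commute (elt z a) (elt z b) := by
  have h := elt_mul_elt z z a b
  rwa [lie_self, elt, elt, elt, TensorProduct.tmul_zero, map_zero, add_zero] at h

theorem isCurrentSl2_eltHom :
    IsCurrentSl2 (eltHom xPlus : A →+ UMap A sl2) (eltHom xMinus) (eltHom hElt) where
  e_mul_f a b := by
    simp only [eltHom_apply]
    rw [elt_mul_elt, lie_xPlus_xMinus]
  h_mul_e a b := by
    simp only [eltHom_apply, AddMonoidHom.nsmul_apply]
    rw [elt_mul_elt, lie_hElt_xPlus, elt_smul, ofNat_smul_eq_nsmul]
  h_mul_f a b := by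
    simp only [eltHom_apply, AddMonoidHom.nsmul_apply, AddMonoidHom.neg_apply]
    rw [elt_mul_elt, lie_hElt_xMinus, elt_smul, neg_smul, ofNat_smul_eq_nsmul]
  e_comm := commute_elt xPlus
  f_comm := commute_elt xMinus

end Relations

/-! ### Coefficients in the span of `B` -/

section Monomials

open MvPowerSeries

variable {A : Type*} {B : Set A}

/-- The variables `s_a` and `t_a` with `a ∈ B`. -/
def varsOf (B : Set A) : Set (A ⊕ A) := Sum.elim id id ⁻¹' B

theorem support_sumElim_subset_varsOf {φ χ : FMultiset A} :
    ((φ.sumElim χ).support : Set (A ⊕ A)) ⊆ varsOf B ↔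
      (φ.support : Set A) ⊆ B ∧ (χ.support : Set A) ⊆ B := by
  simp only [Set.subset_def, Sum.forall]
  simp [varsOf]

variable [CommRing A]

/-- The extra factor `b` is needed for `φ = 0`, since `B` need not contain `1`. -/
theorem mul_prodElt_mem (hB : ∀ a ∈ B, ∀ a' ∈ B, a * a' ∈ B) {φ : FMultiset A}
    (hφ : (φ.support : Set A) ⊆ B) {b : A} (hb : b ∈ B) : b * prodElt φ ∈ B := by
  classical
  have hpow : ∀ a ∈ B, ∀ n : ℕ, ∀ c ∈ B, c * a ^ n ∈ B := by
    intro a ha n c hc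
    induction n with
    | zero => simpa using hc
    | succ n ih =>
      rw [pow_succ, ← mul_assoc]
      exact hB _ ih _ ha
  have key : ∀ s : Finset A, (s : Set A) ⊆ B → b * ∏ a ∈ s, a ^ φ a ∈ B := by
    intro s
    induction s using Finset.induction_on with
    | empty => simpa using hb
    | insert a s ha ih =>
      intro hs
      rw [Finset.coe_insert, Set.insert_subset_iff] at hs
      rw [Finset.prod_insert ha, mul_left_comm, mul_comm]
      exact hpow a hs.1 _ _ (ih hs.2)
  exact key _ hφ

theorem mul_coeff_geomSeries_mem (hB : ∀ a ∈ B, ∀ a' ∈ B, a * a' ∈ B) {m : A ⊕ A →₀ ℕ}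
    (hm : (m.support : Set (A ⊕ A)) ⊆ varsOf B) {b : A} (hb : b ∈ B) :
    b * coeff m (geomSeries A) ∈ AddSubmonoid.closure B := by
  obtain ⟨φ, χ, rfl⟩ := exists_eq_sumElim m
  rw [support_sumElim_subset_varsOf] at hm
  rw [coeff_geomSeries]
  split_ifs
  · have h : b * (geomCoeff φ * geomCoeff χ) =
        (φ.multinomial * χ.multinomial) • (b * prodElt φ * prodElt χ) := by
      rw [geomCoeff, geomCoeff, nsmul_eq_mul, Nat.cast_mul]
      ring
    rw [h]
    exact AddSubmonoid.nsmul_mem _ (AddSubmonoid.subset_closure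
      (mul_prodElt_mem hB hm.2 (mul_prodElt_mem hB hm.1 hb))) _
  · rw [mul_zero]
    exact zero_mem _

theorem coeff_linearSeries_mem {v : A ⊕ A → A} (hv : ∀ i, v i = 0 ∨ v i = Sum.elim id id i)
    {m : A ⊕ A →₀ ℕ} (hm : (m.support : Set (A ⊕ A)) ⊆ varsOf B) :
    coeff m (linearSeries v) ∈ AddSubmonoid.closure B := by
  rcases coeff_linearSeries_eq_zero_or v m with h | ⟨i, rfl, h⟩
  · rw [h]
    exact zero_mem _
  · rw [h]
    rcases hv i with h0 | h0
    · rw [h0]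
      exact zero_mem _
    · rw [h0]
      refine AddSubmonoid.subset_closure (hm ?_)
      simp

end Monomials

/-! ### Generating series of `p` and `D` -/

section Integrality

open MvPowerSeries

variable {A : Type*} [CommRing A] [Algebra ℂ A] {B : Set A} {Z : Subring (UMap A sl2)}

theorem elt_nat_mul {𝔞 : Type*} [LieRing 𝔞] [LieAlgebra ℂ 𝔞] (z : 𝔞) (n : ℕ) (a : A) :
    elt z ((n : A) * a) = (n : ℂ) • elt z a := by
  rw [← nsmul_eq_mul, ← eltHom_apply, map_nsmul, Nat.cast_smul_eq_nsmul, eltHom_apply]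

/-- The generating series `∑ p(φ, χ) s^φ t^χ`. -/
def seriesP (A : Type*) [CommRing A] [Algebra ℂ A] : MvPowerSeries (A ⊕ A) (UMap A sl2) := fun m =>
  p (m.comapDomain Sum.inl Sum.inl_injective.injOn) (m.comapDomain Sum.inr Sum.inr_injective.injOn)

theorem coeff_seriesP (φ χ : FMultiset A) : coeff (φ.sumElim χ) (seriesP A) = p φ χ := by
  rw [coeff_apply, seriesP, Finsupp.comapDomain_inl_sumElim, Finsupp.comapDomain_inr_sumElim]

theorem p_eq_zero_of_degree_ne {φ χ : FMultiset A} (h : φ.degree ≠ χ.degree) : p φ χ = 0 := by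
  rw [p_eq, if_neg h, zero_div, neg_zero, zero_smul]
  rintro ⟨rfl, rfl⟩
  exact h rfl

open scoped Classical in
/-- The recursion for `p`, cleared of the denominator and with the sum restricted to pairs of equal
degree, since `p` vanishes at pairs of distinct degree. -/
theorem degree_smul_p (φ χ : FMultiset A) : φ.degree • p φ χ =
    -∑ ψ₁ ∈ (sub φ).erase 0, ∑ ψ₂ ∈ (sub χ).erase 0, if ψ₁.degree = ψ₂.degree then
      elt hElt (geomCoeff ψ₁ * geomCoeff ψ₂) * p (φ - ψ₁) (χ - ψ₂) else 0 := by
  classical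
  have hsub : ∀ {ψ φ : FMultiset A}, ψ ∈ (sub φ).erase 0 →
      (φ - ψ).degree + ψ.degree = φ.degree := by
    intro ψ φ h
    rw [← map_add, tsub_add_cancel_of_le (mem_sub.mp (Finset.mem_of_mem_erase h))]
  by_cases hd : φ.degree = χ.degree
  · by_cases h0 : φ = 0
    · subst h0
      have : (sub (0 : FMultiset A)).erase 0 = ∅ := by
        ext ψ
        simp [mem_sub]
      simp [this]
    · have hn : (φ.degree : ℂ) ≠ 0 := by
        rwa [Nat.cast_ne_zero, Ne, Finsupp.degree_eq_zero_iff]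
      rw [p_eq (fun h => h0 h.1), if_pos hd, ← Nat.cast_smul_eq_nsmul ℂ, smul_smul, mul_neg,
        mul_one_div_cancel hn, neg_smul, one_smul]
      congr 1
      refine Finset.sum_congr rfl fun ψ₁ h₁ => Finset.sum_congr rfl fun ψ₂ h₂ => ?_
      split_ifs with h
      · rw [geomCoeff, geomCoeff, mul_mul_mul_comm, ← Nat.cast_mul, ← Nat.cast_mul,
          elt_nat_mul,
          smul_mul_assoc]
      · rw [p_eq_zero_of_degree_ne, mul_zero, smul_zero]
        have := hsub h₁
        have := hsub h₂
        omega
  · rw [p_eq_zero_of_degree_ne hd, smul_zero, eq_comm, neg_eq_zero]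
    refine Finset.sum_eq_zero fun ψ₁ h₁ => Finset.sum_eq_zero fun ψ₂ h₂ => ?_
    split_ifs with h
    · rw [p_eq_zero_of_degree_ne, mul_zero]
      have := hsub h₁
      have := hsub h₂
      omega
    · rfl

/-- The recursion that defines `p`, as a differential equation for its generating series. -/
theorem euler_seriesP : euler leftDegree (seriesP A) =
    -coeffMap (eltHom hElt) (seriesS A * seriesT A * geomSeries A) * seriesP A := by
  classical
  have hu : seriesS A * seriesT A * geomSeries A = geomSeries A - 1 :=
    eq_sub_of_add_eq' geomSeries_eq.symm
  ext m
  obtain ⟨φ, χ, rfl⟩ := exists_eq_sumElim m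
  rw [coeff_euler, leftDegree_sumElim, coeff_seriesP, degree_smul_p, neg_mul, map_neg,
    coeff_sumElim_mul, hu]
  congr 1
  have hc : ∀ ψ₁ ψ₂ : FMultiset A, ¬(ψ₁ = 0 ∧ ψ₂ = 0) →
      coeff (ψ₁.sumElim ψ₂) (coeffMap (eltHom hElt) (geomSeries A - 1)) =
        if ψ₁.degree = ψ₂.degree then elt hElt (geomCoeff ψ₁ * geomCoeff ψ₂) else 0 := by
    intro ψ₁ ψ₂ h
    rw [coeff_coeffMap, map_sub, coeff_geomSeries, coeff_one,
      if_neg fun h0 => h (sumElim_eq_zero.mp h0), sub_zero]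
    split_ifs
    · rfl
    · exact map_zero _
  have hz : ∀ ψ₁ ψ₂ : FMultiset A, ψ₁ = 0 ∨ ψ₂ = 0 →
      coeff (ψ₁.sumElim ψ₂) (coeffMap (eltHom hElt) (geomSeries A - 1)) = 0 := by
    intro ψ₁ ψ₂ h
    -- The constant term is removed by `- 1`; otherwise the degrees are distinct.
    by_cases h0 : ψ₁ = 0 ∧ ψ₂ = 0
    · rw [h0.1, h0.2, coeff_coeffMap, map_sub, coeff_geomSeries, Finsupp.sumElim_zero_zero]
      simp
    · rw [hc _ _ h0, if_neg]
      intro hd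
      rcases h with rfl | rfl
      · exact h0 ⟨rfl, (Finsupp.degree_eq_zero_iff _).mp (hd.symm.trans (map_zero _))⟩
      · exact h0 ⟨(Finsupp.degree_eq_zero_iff _).mp (hd.trans (map_zero _)), rfl⟩
  refine Finset.sum_subset_zero_on_sdiff (Finset.erase_subset _ _) ?_ fun ψ₁ h₁ =>
    Finset.sum_subset_zero_on_sdiff (Finset.erase_subset _ _) ?_ fun ψ₂ h₂ => ?_
  · intro ψ₁ h₁
    have : ψ₁ = 0 := by
      by_contra h
      simp_all
    exact Finset.sum_eq_zero fun ψ₂ _ => by rw [hz _ _ (Or.inl this), zero_mul]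
  · intro ψ₂ h₂
    have : ψ₂ = 0 := by
      by_contra h
      simp_all
    rw [hz _ _ (Or.inr this), zero_mul]
  · rw [hc _ _ fun h => (Finset.mem_erase.mp h₁).1 h.1, ite_mul, zero_mul, coeff_seriesP]

theorem weightZero_seriesP : weightZero leftDegree (seriesP A) = 1 := by
  classical
  ext m
  obtain ⟨φ, χ, rfl⟩ := exists_eq_sumElim m
  rw [coeff_weightZero, leftDegree_sumElim, coeff_seriesP, coeff_one, if_congr sumElim_eq_zero rfl
    rfl, if_congr (Finsupp.degree_eq_zero_iff _) rfl rfl]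
  by_cases hφ : φ = 0
  · by_cases hχ : χ = 0
    · simp [hφ, hχ, p_zero]
    · rw [if_pos hφ, if_neg (fun h => hχ h.2), p_eq_zero_of_degree_ne]
      rw [hφ, map_zero]
      exact fun h => hχ ((Finsupp.degree_eq_zero_iff _).mp h.symm)
  · rw [if_neg hφ, if_neg (fun h => hφ h.1)]

theorem hasDividedPowers_elt {x : sl2} (hx : ∀ a ∈ B, HasDividedPowers Z (elt x a)) {a : A}
    (ha : a ∈ AddSubmonoid.closure B) : HasDividedPowers Z (eltHom x a) := by
  induction ha using AddSubmonoid.closure_induction with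
  | mem a ha => exact hx a ha
  | zero =>
    rw [map_zero]
    exact hasDividedPowers_zero
  | add a b _ _ iha ihb =>
    rw [map_add]
    exact iha.add ihb (commute_elt x a b)

/-- Series with coefficients in the span of `B` over `ℕ` have integral divided powers. -/
theorem hasDividedPowers_coeffMap {x : sl2} (hx : ∀ a ∈ B, HasDividedPowers Z (elt x a))
    {f : MvPowerSeries (A ⊕ A) A} (hf : ∀ m : A ⊕ A →₀ ℕ, (m.support : Set (A ⊕ A)) ⊆ varsOf B →
      coeff m f ∈ AddSubmonoid.closure B) :
    HasDividedPowers (seriesSubring Z (varsOf B)) (coeffMap (eltHom x) f) :=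
  hasDividedPowers_series (fun _ _ => commute_elt x _ _) fun m hm =>
    hasDividedPowers_elt hx (hf m hm)

/-- The elements `p(φ, χ)` are integral, because their generating series is a product of
exponentials of integral series. -/
theorem p_mem (hB : ∀ a ∈ B, ∀ a' ∈ B, a * a' ∈ B)
    (hp : ∀ a ∈ B, HasDividedPowers Z (elt xPlus a))
    (hm : ∀ a ∈ B, HasDividedPowers Z (elt xMinus a)) {φ χ : FMultiset A}
    (hφ : (φ.support : Set A) ⊆ B) (hχ : (χ.support : Set A) ⊆ B) : p φ χ ∈ Z := by
  have hS : ∀ m : A ⊕ A →₀ ℕ, (m.support : Set (A ⊕ A)) ⊆ varsOf B →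
      coeff m (seriesS A) ∈ AddSubmonoid.closure B := fun m =>
    coeff_linearSeries_mem (by rintro (a | a) <;> simp)
  have hT : ∀ m : A ⊕ A →₀ ℕ, (m.support : Set (A ⊕ A)) ⊆ varsOf B →
      coeff m (seriesT A) ∈ AddSubmonoid.closure B := fun m =>
    coeff_linearSeries_mem (by rintro (a | a) <;> simp)
  have hSg : ∀ m : A ⊕ A →₀ ℕ, (m.support : Set (A ⊕ A)) ⊆ varsOf B →
      coeff m (seriesS A * geomSeries A) ∈ AddSubmonoid.closure B := by
    intro m h
    obtain ⟨φ, χ, rfl⟩ := exists_eq_sumElim m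
    rw [coeff_seriesS_mul]
    rw [support_sumElim_subset_varsOf] at h
    refine sum_mem fun a ha => mul_coeff_geomSeries_mem hB ?_ (h.1 ha)
    rw [support_sumElim_subset_varsOf]
    exact ⟨(Finset.coe_subset.mpr (Finsupp.support_mono tsub_le_self)).trans h.1, h.2⟩
  have hTg : ∀ m : A ⊕ A →₀ ℕ, (m.support : Set (A ⊕ A)) ⊆ varsOf B →
      coeff m (seriesT A * geomSeries A) ∈ AddSubmonoid.closure B := by
    intro m h
    obtain ⟨φ, χ, rfl⟩ := exists_eq_sumElim m
    rw [coeff_seriesT_mul]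
    rw [support_sumElim_subset_varsOf] at h
    refine sum_mem fun a ha => mul_coeff_geomSeries_mem hB ?_ (h.2 ha)
    rw [support_sumElim_subset_varsOf]
    exact ⟨h.1, (Finset.coe_subset.mpr (Finsupp.support_mono tsub_le_self)).trans h.2⟩
  have key : seriesP A ∈ seriesSubring Z (varsOf B) := by
    rw [isCurrentSl2_eltHom.eq_mvExp_prod leftDegree geomSeries_eq (constantCoeff_linearSeries _)
      (constantCoeff_linearSeries _) euler_seriesS euler_seriesT weightZero_seriesS euler_seriesP
      weightZero_seriesP, map_neg, map_neg]
    exact mul_mem (mul_mem (mul_mem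
      (mvExp_mem_seriesSubring (hasDividedPowers_coeffMap hm hTg))
      (mvExp_mem_seriesSubring (hasDividedPowers_coeffMap hp hS)))
      (mvExp_mem_seriesSubring (hasDividedPowers_coeffMap hm hT).neg))
      (mvExp_mem_seriesSubring (hasDividedPowers_coeffMap hp hSg).neg)
  rw [← coeff_seriesP]
  exact key _ (support_sumElim_subset_varsOf.mpr ⟨hφ, hχ⟩)

/-- The generating series `∑ D(φ, χ, χ_b) s^φ t^χ = x ⊗ b (1 - ST)⁻¹`. -/
def seriesD (x : sl2) (b : A) : MvPowerSeries (A ⊕ A) (UMap A sl2) :=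
  coeffMap (eltHom x) (C b * geomSeries A)

theorem coeff_seriesD (x : sl2) (b : A) (φ χ : FMultiset A) :
    coeff (φ.sumElim χ) (seriesD x b) = DSingle x φ χ b := by
  rw [seriesD, coeff_coeffMap, coeff_C_mul, coeff_geomSeries, DSingle]
  split_ifs
  · rw [eltHom_apply, ← Nat.cast_mul, ← elt_nat_mul, geomCoeff, geomCoeff, Nat.cast_mul]
    congr 1
    ring
  · rw [mul_zero, map_zero]

/-- `D(φ, χ, ψ)` is the coefficient at `s^φ t^χ w^ψ` of a divided power of
`∑ b, (x ⊗ b (1 - ST)⁻¹) w_b`. -/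
theorem coeff_dividedPower_seriesD (x : sl2) (φ χ ψ : FMultiset A) :
    coeff (φ.sumElim χ) (coeff ψ (dividedPower (linearSeries (seriesD x)) ψ.degree)) =
      D x φ χ ψ := by
  classical
  induction hn : ψ.degree generalizing φ χ ψ with
  | zero =>
    obtain rfl := (Finsupp.degree_eq_zero_iff _).mp hn
    rw [dividedPower_zero_right, coeff_one, if_pos rfl, coeff_one, D_zero,
      if_congr sumElim_eq_zero rfl rfl]
    simp only [Nat.add_eq_zero_iff, Finsupp.degree_eq_zero_iff]
  | succ n ih =>
    have hψ : ψ ≠ 0 := by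
      rintro rfl
      simp at hn
    rw [D_eq' x φ χ hψ, hn, dividedPower_succ, coeff_complex_smul, coeff_complex_smul, Nat.cast_add,
      Nat.cast_one, coeff_linearSeries_mul, map_sum]
    congr 1
    have h : ∀ b ∈ ψ.support, coeff (φ.sumElim χ) (seriesD x b *
        coeff (ψ - Finsupp.single b 1) (dividedPower (linearSeries (seriesD x)) n)) =
        ∑ φ₁ ∈ sub φ, ∑ φ₂ ∈ sub χ,
          DSingle x φ₁ φ₂ b * D x (φ - φ₁) (χ - φ₂) (ψ - Finsupp.single b 1) := by
      intro b hb
      rw [coeff_sumElim_mul]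
      refine Finset.sum_congr rfl fun φ₁ _ => Finset.sum_congr rfl fun φ₂ _ => ?_
      rw [coeff_seriesD, ih]
      have := degree_tsub_single hb
      omega
    rw [Finset.sum_congr rfl h, Finset.sum_comm]
    exact Finset.sum_congr rfl fun φ₁ _ => Finset.sum_comm

/-- The elements `D(φ, χ, ψ)` are integral: the coefficients `x ⊗ b (1 - ST)⁻¹` commute and have
integral divided powers, hence so does the generating series. -/
theorem D_mem (hB : ∀ a ∈ B, ∀ a' ∈ B, a * a' ∈ B) {x : sl2}
    (hx : ∀ a ∈ B, HasDividedPowers Z (elt x a)) {φ χ ψ : FMultiset A}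
    (hφ : (φ.support : Set A) ⊆ B) (hχ : (χ.support : Set A) ⊆ B)
    (hψ : (ψ.support : Set A) ⊆ B) : D x φ χ ψ ∈ Z := by
  have hcomm : ∀ a b : A, Commute (seriesD x a) (seriesD x b) := fun a b =>
    commute_of_coeff fun _ _ => commute_elt x _ _
  have hD : ∀ b ∈ B, HasDividedPowers (seriesSubring Z (varsOf B)) (seriesD x b) := by
    intro b hb
    refine hasDividedPowers_coeffMap hx fun m hm => ?_
    rw [coeff_C_mul]
    exact mul_coeff_geomSeries_mem hB hm hb
  have key : HasDividedPowers (seriesSubring (seriesSubring Z (varsOf B)) B)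
      (linearSeries (seriesD x)) := by
    refine hasDividedPowers_series (fun m n => ?_) fun m hm => ?_
    · rcases coeff_linearSeries_eq_zero_or (seriesD x) m with h | ⟨a, _, h⟩
      · rw [h]
        exact Commute.zero_left _
      · rcases coeff_linearSeries_eq_zero_or (seriesD x) n with h' | ⟨b, _, h'⟩
        · rw [h']
          exact Commute.zero_right _
        · rw [h, h']
          exact hcomm a b
    · rcases coeff_linearSeries_eq_zero_or (seriesD x) m with h | ⟨a, rfl, h⟩
      · rw [h]
        exact hasDividedPowers_zero
      · rw [h]
        exact hD a (hm (by simp))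
  rw [← coeff_dividedPower_seriesD]
  exact key _ _ hψ _ (support_sumElim_subset_varsOf.mpr ⟨hφ, hχ⟩)

end Integrality

end MapAlg

end

theorem mainTheorem4 {𝔤 : Type*} [LieRing 𝔤] [LieAlgebra ℂ 𝔤] [FiniteDimensional ℂ 𝔤]
    [LieAlgebra.IsSimple ℂ 𝔤]
    (H : LieSubalgebra ℂ 𝔤) [H.IsCartanSubalgebra]
    (b : (LieAlgebra.IsKilling.rootSystem H).Base)
    (X : MapAlg.ChevalleyBasis H)
    {A : Type*} [CommRing A] [Algebra ℂ A]
    (B : Set A)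
    (hB_indep : LinearIndependent ℂ (fun a : B => (a : A)))
    (hB_span : Submodule.span ℂ B = ⊤)
    (hB_mul : ∀ a ∈ B, ∀ a' ∈ B, a * a' ∈ B)
    (α : H.root) (hα : α ∈ MapAlg.positiveRoots b) :
    (∀ φ χ ψ : MapAlg.FMultiset A,
      (φ.support : Set A) ⊆ B → (χ.support : Set A) ⊆ B → (ψ.support : Set A) ⊆ B →
        MapAlg.DPlus X α φ χ ψ ∈ MapAlg.UZ b X B ∧
        MapAlg.DMinus X α φ χ ψ ∈ MapAlg.UZ b X B) ∧
    (∀ φ χ : MapAlg.FMultiset A,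
      (φ.support : Set A) ⊆ B → (χ.support : Set A) ⊆ B →
        MapAlg.pRoot X α φ χ ∈ MapAlg.UZ b X B) := by
  -- It suffices to work in `U(𝔰𝔩₂ ⊗ A)`, with the preimage of the integral form under `Ω_α`.
  let Z : Subring (MapAlg.UMap A MapAlg.sl2) :=
    (MapAlg.UZ b X B).toSubring.comap (MapAlg.Omega X α).toRingHom
  have hdp : ∀ (u : MapAlg.UMap A MapAlg.sl2) (r : ℕ), MapAlg.Omega X α (MapAlg.dividedPower u r) =
      MapAlg.dividedPower (MapAlg.Omega X α u) r := fun u r => by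
    rw [MapAlg.dividedPower, map_smul, map_pow, MapAlg.dividedPower]
  have hp : ∀ a ∈ B, MapAlg.HasDividedPowers Z (MapAlg.elt MapAlg.xPlus a) := by
    intro a ha r
    change MapAlg.Omega X α _ ∈ MapAlg.UZ b X B
    rw [hdp, MapAlg.Omega_xPlus]
    exact Algebra.subset_adjoin ⟨α, hα, a, ha, r, Or.inl rfl⟩
  have hm : ∀ a ∈ B, MapAlg.HasDividedPowers Z (MapAlg.elt MapAlg.xMinus a) := by
    intro a ha r
    change MapAlg.Omega X α _ ∈ MapAlg.UZ b X B
    rw [hdp, MapAlg.Omega_xMinus]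
    exact Algebra.subset_adjoin ⟨α, hα, a, ha, r, Or.inr rfl⟩
  exact ⟨fun φ χ ψ hφ hχ hψ => ⟨MapAlg.D_mem (Z := Z) hB_mul hp hφ hχ hψ,
    MapAlg.D_mem (Z := Z) hB_mul hm hφ hχ hψ⟩,
    fun φ χ hφ hχ => MapAlg.p_mem (Z := Z) hB_mul hp hm hφ hχ⟩
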